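/- Let $\mu_D$ be a compactly supported probability measure on $\mathbb{R}$, let $t>0$, let $\rho_{\mathrm{sc},t}(dx)=\frac{\sqrt{4t-x^2}}{2\pi t}\mathbf 1_{|x|\le 2\sqrt t}\,dx$ be the semicircle law of variance $t$, and let $\mu_t=\rho_{\mathrm{sc},t}\boxplus\mu_D$ be the free additive convolution, i.e. the distribution of $a+b$ for free self-adjoint elements $a,b$ of a $C^*$-probability space with distributions $\rho_{\mathrm{sc},t}$ and $\mu_D$. Let $\ell_t=\min\operatorname{supp}\mu_t$ be its left edge. Then $\mu_t$ has a continuous density $\mu_t(\cdot)\ge 0$ with respect to Lebesgue measure, and this density decays at least as fast as a square root at the left edge: there exist $c,\epsilon>0$ (depending on $\mu_D$ and $t$) such that \[ \mu_t(x)\le c\sqrt{x-\ell_t}\qquad\text{for all } x\in[\ell_t,\ell_t+\epsilon]. \] -/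

import Mathlib

open MeasureTheory

/-- The semicircle law of variance `t > 0`, with density `√(4t - x²) / (2πt)` on `[-2√t, 2√t]`. Outside
this interval the argument of the square root is negative, so that `Real.sqrt` is `0` there. -/
noncomputable def semicircleLaw (t : ℝ) : Measure ℝ :=
  volume.withDensity fun x => ENNReal.ofReal (Real.sqrt (4 * t - x ^ 2) / (2 * Real.pi * t))

/-- The left edge of a (compactly supported) measure on the line: the infimum of its support. -/
noncomputable def leftEdge (μ : Measure ℝ) : ℝ := sInf μ.support

/-- A state on a unital C⋆-algebra: a unital positive linear functional. (Positive functionals on a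
C⋆-algebra are automatically continuous, so taking `φ` continuous is no restriction.) -/
structure IsState {A : Type*} [CStarAlgebra A] (φ : A →L[ℂ] ℂ) : Prop where
  map_one : φ 1 = 1
  re_nonneg : ∀ x : A, 0 ≤ (φ (star x * x)).re
  im_eq_zero : ∀ x : A, (φ (star x * x)).im = 0

/-- Free independence of a family of unital subalgebras with respect to a functional `φ`: `φ`
vanishes on every nonempty product `x₁ x₂ ⋯ xₙ` of centred elements `xₖ ∈ S (iₖ)` in which
neighbouring factors come from different subalgebras. -/
def FreelyIndependent {ι A : Type*} [CStarAlgebra A] (φ : A →L[ℂ] ℂ)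
    (S : ι → Subalgebra ℂ A) : Prop :=
  ∀ l : List (ι × A), l ≠ [] → l.IsChain (fun p q => p.1 ≠ q.1) →
    (∀ p ∈ l, p.2 ∈ S p.1 ∧ φ p.2 = 0) → φ (l.map Prod.snd).prod = 0

/-- Two self-adjoint elements are free if the unital (⋆-)subalgebras that they generate are. -/
def AreFree {A : Type*} [CStarAlgebra A] (φ : A →L[ℂ] ℂ) (a b : A) : Prop :=
  FreelyIndependent φ
    (fun i : Bool => if i then Algebra.adjoin ℂ {a} else Algebra.adjoin ℂ {b})

/-- `μ` is the distribution of the self-adjoint element `a` with respect to `φ`: the compactly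
supported probability measure on the line whose moments are `φ (a ^ k)`. -/
structure HasDistribution {A : Type*} [CStarAlgebra A] (φ : A →L[ℂ] ℂ) (a : A)
    (μ : Measure ℝ) : Prop where
  isProbabilityMeasure : IsProbabilityMeasure μ
  isCompact_support : IsCompact μ.support
  moment_eq : ∀ k : ℕ, φ (a ^ k) = ((∫ x, x ^ k ∂μ : ℝ) : ℂ)

/-- `ρ = μ ⊞ ν`, the free additive convolution of the compactly supported probability measures
`μ` and `ν` on the line: `ρ` is the distribution of `a + b`, where `a` and `b` are free self-adjoint
elements of a C⋆-probability space with distributions `μ` and `ν`. -/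
def IsFreeConvolution (μ ν ρ : Measure ℝ) : Prop :=
  ∃ (A : Type) (_ : CStarAlgebra A) (φ : A →L[ℂ] ℂ) (a b : A),
    IsState φ ∧ IsSelfAdjoint a ∧ IsSelfAdjoint b ∧ AreFree φ a b ∧
      HasDistribution φ a μ ∧ HasDistribution φ b ν ∧ HasDistribution φ (a + b) ρ

open Filter Topology Set

/-! Write `m` and `m_D` for the Stieltjes transforms of `μ_t` and `μ_D` (called `μ` and `ν` below).
Everything rests on the functional equation `m(z) = m_D(w)`, `w = z + t m(z)`, on the upper half
plane (`SemicircleSubordinate`). It comes from freeness: the inverse functions of the Cauchy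
transforms satisfy `K_{a+b}(g) = K_a(g) + K_b(g) - 1/g` (`AreFree.map_inverse_add_eq`), and `K_a(g)
= 1/g + t g` for the semicircle law (`integral_semicircleLaw_inv`). This gives the equation near
infinity, and the identity theorem extends it.

Imaginary parts of the equation give `t ∫ |x - w|⁻² dμ_D ≤ 1` (`mul_integral_norm_sq_le_one`). In
the resolvent identity `z₁ - z₂ = (w₁ - w₂)(1 - t ∫ (x - w₁)⁻¹ (x - w₂)⁻¹ dμ_D)` the last factor
then has real part at least `(t/2)(Im m(z₁) + Im m(z₂))²`. Hence `Im m` is Hölder continuous of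
exponent `1/3`, extends continuously to the real line, and `Im m / π` is the density by Stieltjes
inversion.

At the edge, compare `z` with a real `s < ℓ_t`. The point `σ = s + t m(s)` lies to the left of the
support of `μ_D`, since `μ_D` has mass at most `r²/t` in the ball of radius `r` about each such `σ`
(`add_mul_realStieltjes_lt_leftEdge`). In `z - s = (w - σ)(1 - t ∫ (x - w)⁻¹ (x - σ)⁻¹ dμ_D)` both
factors are bounded below by multiples of `Im m(z)`, so `(Im m(z))² ≤ C |z - s|`
(`sq_mul_im_sq_le`). Letting `z → x` and `s → ℓ_t` gives the square root. -/

/-! ### Stieltjes transforms off the support. -/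

/-- The Stieltjes transform `z ↦ ∫ (x - z)⁻¹ dμ(x)` of a measure on the line. -/
noncomputable def stieltjes (μ : Measure ℝ) (z : ℂ) : ℂ := ∫ x : ℝ, ((x : ℂ) - z)⁻¹ ∂μ

theorem resolvent_ofReal (z : ℂ) (x : ℝ) : resolvent z x = ((x : ℂ) - z)⁻¹ := by
  simp [resolvent, Ring.inverse_eq_inv']

theorem stieltjes_eq_resolventTransform (μ : Measure ℝ) : stieltjes μ = resolventTransform μ := by
  ext z
  simp only [stieltjes, resolventTransform_apply, resolvent_ofReal]

/-- A complex number that is not in the support of the measure `μ` on the line. -/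
def OffSupport (μ : Measure ℝ) (z : ℂ) : Prop := z ∉ Complex.ofReal '' μ.support

theorem offSupport_of_im_pos {μ : Measure ℝ} {z : ℂ} (hz : 0 < z.im) : OffSupport μ z := by
  rintro ⟨x, -, rfl⟩
  simp at hz

theorem offSupport_ofReal {μ : Measure ℝ} {s : ℝ} (hs : s ∉ μ.support) : OffSupport μ s := by
  rintro ⟨x, hx, h⟩
  rw [Complex.ofReal_inj] at h
  exact hs (h ▸ hx)

section

variable {μ : Measure ℝ} {z w : ℂ}

theorem OffSupport.exists_norm_inv_le (hz : OffSupport μ z) :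
    ∃ C : ℝ, ∀ᵐ x : ℝ ∂μ, ‖((x : ℂ) - z)⁻¹‖ ≤ C := by
  refine ⟨(Metric.infDist z (algebraMap ℝ ℂ '' μ.support))⁻¹, ?_⟩
  filter_upwards [Measure.support_mem_ae (μ := μ)] with x hx
  rw [← resolvent_ofReal]
  exact norm_resolvent_le_inv_infDist_support hz hx

theorem OffSupport.ae_sub_ne_zero (hz : OffSupport μ z) : ∀ᵐ x : ℝ ∂μ, (x : ℂ) - z ≠ 0 := by
  filter_upwards [Measure.support_mem_ae (μ := μ)] with x hx h
  exact hz ⟨x, hx, sub_eq_zero.mp h⟩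

variable [IsFiniteMeasure μ]

theorem OffSupport.differentiableAt (hz : OffSupport μ z) :
    DifferentiableAt ℂ (stieltjes μ) z := by
  rw [stieltjes_eq_resolventTransform]
  exact (hasDerivAt_resolventTransform z hz).differentiableAt

theorem OffSupport.continuousAt (hz : OffSupport μ z) : ContinuousAt (stieltjes μ) z :=
  hz.differentiableAt.continuousAt

theorem OffSupport.memLp (hz : OffSupport μ z) (p : ENNReal) :
    MemLp (fun x : ℝ => ((x : ℂ) - z)⁻¹) p μ := by
  obtain ⟨C, hC⟩ := hz.exists_norm_inv_le
  exact MemLp.of_bound (by fun_prop) C hC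

theorem OffSupport.integrable (hz : OffSupport μ z) :
    Integrable (fun x : ℝ => ((x : ℂ) - z)⁻¹) μ :=
  (hz.memLp 1).integrable le_rfl

theorem OffSupport.integrable_mul (hz : OffSupport μ z) (hw : OffSupport μ w) :
    Integrable (fun x : ℝ => ((x : ℂ) - z)⁻¹ * ((x : ℂ) - w)⁻¹) μ :=
  (hz.memLp 2).integrable_mul (hw.memLp 2)

/-- The resolvent identity for Stieltjes transforms. -/
theorem stieltjes_sub (hz : OffSupport μ z) (hw : OffSupport μ w) :
    stieltjes μ z - stieltjes μ w =
      (z - w) * ∫ x : ℝ, ((x : ℂ) - z)⁻¹ * ((x : ℂ) - w)⁻¹ ∂μ := by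
  rw [stieltjes, stieltjes, ← integral_sub hz.integrable hw.integrable, ← integral_const_mul]
  refine integral_congr_ae ?_
  filter_upwards [hz.ae_sub_ne_zero, hw.ae_sub_ne_zero] with x h1 h2
  field_simp
  ring

theorem OffSupport.integrable_norm_sq (hz : OffSupport μ z) :
    Integrable (fun x : ℝ => ‖((x : ℂ) - z)⁻¹‖ ^ 2) μ := by
  exact (hz.memLp 2).norm.integrable_sq

theorem im_inv_ofReal_sub (x : ℝ) (z : ℂ) :
    (((x : ℂ) - z)⁻¹).im = z.im * ‖((x : ℂ) - z)⁻¹‖ ^ 2 := by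
  rw [Complex.inv_im, norm_inv, inv_pow, ← Complex.normSq_eq_norm_sq]
  simp [div_eq_mul_inv]

theorem stieltjes_im (hz : OffSupport μ z) :
    (stieltjes μ z).im = z.im * ∫ x : ℝ, ‖((x : ℂ) - z)⁻¹‖ ^ 2 ∂μ := by
  rw [stieltjes, ← integral_const_mul]
  simp_rw [← im_inv_ofReal_sub]
  exact ((Complex.imCLM.integral_comp_comm hz.integrable).symm)

end

/-! ### Quantitative injectivity of `w ↦ w - t m(w)`. -/

theorem sq_integral_le_integral_sq {α : Type*} [MeasurableSpace α] {μ : Measure α}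
    [IsProbabilityMeasure μ] {f : α → ℝ} (hf : MemLp f 2 μ) :
    (∫ x, f x ∂μ) ^ 2 ≤ ∫ x, f x ^ 2 ∂μ := by
  have h := ProbabilityTheory.variance_nonneg f μ
  rw [ProbabilityTheory.variance_eq_sub hf] at h
  simpa using h

section

variable {ν : Measure ℝ} [IsProbabilityMeasure ν] {t : ℝ} {w₁ w₂ : ℂ}

theorem sq_stieltjes_im_le (h : OffSupport ν w₁) :
    (stieltjes ν w₁).im ^ 2 ≤ ∫ x : ℝ, ‖((x : ℂ) - w₁)⁻¹‖ ^ 2 ∂ν := by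
  have h1 : (stieltjes ν w₁).im = ∫ x : ℝ, (((x : ℂ) - w₁)⁻¹).im ∂ν :=
    (Complex.imCLM.integral_comp_comm h.integrable).symm
  rw [h1]
  refine (sq_integral_le_integral_sq (h.memLp 2).im).trans ?_
  refine integral_mono ?_ h.integrable_norm_sq fun x => ?_
  · exact (h.memLp 2).im.integrable_sq
  · exact sq_le_sq' (neg_le_of_abs_le (Complex.abs_im_le_norm _))
      (le_of_abs_le (Complex.abs_im_le_norm _))

/-- With `pᵢ = (x - wᵢ)⁻¹`, one has `|p₁|² + |p₂|² - 2 Re(p₁p₂) = |p₁ - conj p₂|² ≥ (Im p₁ + Im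
p₂)²`. Integrate, use Jensen on the right and the two bounds `t ∫ |pᵢ|² ≤ 1` on the left. -/
theorem re_one_sub_integral_mul_ge (ht : 0 ≤ t) (h₁ : OffSupport ν w₁) (h₂ : OffSupport ν w₂)
    (hI₁ : t * ∫ x : ℝ, ‖((x : ℂ) - w₁)⁻¹‖ ^ 2 ∂ν ≤ 1)
    (hI₂ : t * ∫ x : ℝ, ‖((x : ℂ) - w₂)⁻¹‖ ^ 2 ∂ν ≤ 1) :
    t / 2 * ((stieltjes ν w₁).im + (stieltjes ν w₂).im) ^ 2 ≤
      (1 - t * ∫ x : ℝ, ((x : ℂ) - w₁)⁻¹ * ((x : ℂ) - w₂)⁻¹ ∂ν).re := by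
  have e1 : (∫ x : ℝ, ((x : ℂ) - w₁)⁻¹ * ((x : ℂ) - w₂)⁻¹ ∂ν).re =
      ∫ x : ℝ, (((x : ℂ) - w₁)⁻¹ * ((x : ℂ) - w₂)⁻¹).re ∂ν :=
    (Complex.reCLM.integral_comp_comm (h₁.integrable_mul h₂)).symm
  have e2 (w : ℂ) (h : OffSupport ν w) :
      (stieltjes ν w).im = ∫ x : ℝ, (((x : ℂ) - w)⁻¹).im ∂ν :=
    (Complex.imCLM.integral_comp_comm h.integrable).symm
  have i1 : Integrable (fun x : ℝ => (((x : ℂ) - w₁)⁻¹ * ((x : ℂ) - w₂)⁻¹).re) ν :=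
    (h₁.integrable_mul h₂).re
  have m : MemLp (fun x : ℝ => (((x : ℂ) - w₁)⁻¹).im + (((x : ℂ) - w₂)⁻¹).im) 2 ν :=
    (h₁.memLp 2).im.add (h₂.memLp 2).im
  have e3 : ((stieltjes ν w₁).im + (stieltjes ν w₂).im) ^ 2 ≤
      ∫ x : ℝ, ((((x : ℂ) - w₁)⁻¹).im + (((x : ℂ) - w₂)⁻¹).im) ^ 2 ∂ν := by
    have i2 := integral_add h₁.integrable.im h₂.integrable.im
    simp only [RCLike.im_to_complex] at i2
    rw [e2 _ h₁, e2 _ h₂, ← i2]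
    exact sq_integral_le_integral_sq m
  have e4 : ∫ x : ℝ, ((((x : ℂ) - w₁)⁻¹).im + (((x : ℂ) - w₂)⁻¹).im) ^ 2 ∂ν ≤
      ∫ x : ℝ, (‖((x : ℂ) - w₁)⁻¹‖ ^ 2 + ‖((x : ℂ) - w₂)⁻¹‖ ^ 2) -
        2 * (((x : ℂ) - w₁)⁻¹ * ((x : ℂ) - w₂)⁻¹).re ∂ν := by
    refine integral_mono m.integrable_sq
      ((h₁.integrable_norm_sq.add h₂.integrable_norm_sq).sub (i1.const_mul 2)) fun x => ?_
    simp only [Complex.sq_norm, Complex.normSq_apply, Complex.mul_re]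
    nlinarith [sq_nonneg ((((x : ℂ) - w₁)⁻¹).re - (((x : ℂ) - w₂)⁻¹).re)]
  have i3 := h₁.integrable_norm_sq.add h₂.integrable_norm_sq
  simp only [Pi.add_def] at i3
  rw [integral_sub i3 (i1.const_mul 2), integral_add h₁.integrable_norm_sq h₂.integrable_norm_sq,
    integral_const_mul] at e4
  rw [Complex.sub_re, Complex.one_re, Complex.re_ofReal_mul, e1]
  nlinarith [mul_le_mul_of_nonneg_left (e3.trans e4) ht]

/-- A quantitative form of the injectivity of `w ↦ w - t m(w)`, where `m` is the Stieltjes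
transform of `ν`, on the set where its imaginary part is positive. -/
theorem norm_sub_mul_sq_le (ht : 0 ≤ t) (h₁ : OffSupport ν w₁) (h₂ : OffSupport ν w₂)
    (hI₁ : t * ∫ x : ℝ, ‖((x : ℂ) - w₁)⁻¹‖ ^ 2 ∂ν ≤ 1)
    (hI₂ : t * ∫ x : ℝ, ‖((x : ℂ) - w₂)⁻¹‖ ^ 2 ∂ν ≤ 1) :
    ‖w₁ - w₂‖ * (t / 2 * ((stieltjes ν w₁).im + (stieltjes ν w₂).im) ^ 2) ≤
      ‖(w₁ - t * stieltjes ν w₁) - (w₂ - t * stieltjes ν w₂)‖ := by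
  have : (w₁ - t * stieltjes ν w₁) - (w₂ - t * stieltjes ν w₂) =
      (w₁ - w₂) * (1 - t * ∫ x : ℝ, ((x : ℂ) - w₁)⁻¹ * ((x : ℂ) - w₂)⁻¹ ∂ν) := by
    linear_combination (-t : ℂ) * stieltjes_sub h₁ h₂
  rw [this, norm_mul]
  gcongr
  exact (re_one_sub_integral_mul_ge ht h₁ h₂ hI₁ hI₂).trans (Complex.re_le_norm _)

end

/-! ### The functional equation and continuity up to the real line. -/

theorem stieltjes_im_nonneg {μ : Measure ℝ} [IsFiniteMeasure μ] {z : ℂ} (hz : 0 < z.im) :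
    0 ≤ (stieltjes μ z).im := by
  rw [stieltjes_im (offSupport_of_im_pos hz)]
  exact mul_nonneg hz.le (integral_nonneg fun x => by positivity)

/-- `μ` and `ν` satisfy the functional equation `m_μ(z) = m_ν(z + t m_μ(z))` on the upper half
plane: the relation between the Stieltjes transforms of `ν` and of the free convolution of `ν` with
the semicircle law of variance `t`. -/
def SemicircleSubordinate (t : ℝ) (μ ν : Measure ℝ) : Prop :=
  ∀ z : ℂ, 0 < z.im → stieltjes μ z = stieltjes ν (z + t * stieltjes μ z)

namespace SemicircleSubordinate

variable {t : ℝ} {μ ν : Measure ℝ} [IsProbabilityMeasure μ]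

theorem im_le_im_add (ht : 0 ≤ t) {z : ℂ} (hz : 0 < z.im) :
    z.im ≤ (z + t * stieltjes μ z).im := by
  simpa using mul_nonneg ht (stieltjes_im_nonneg hz)

theorem offSupport (ht : 0 ≤ t) {z : ℂ} (hz : 0 < z.im) :
    OffSupport ν (z + t * stieltjes μ z) :=
  offSupport_of_im_pos (hz.trans_le (im_le_im_add ht hz))

variable [IsProbabilityMeasure ν]

/-- With `w = z + t m(z)`, the equation gives `Im m(z) = Im w · ∫ |x - w|⁻²`, while `t Im m(z) = Im
w - Im z < Im w`. Divide by `Im w`. -/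
theorem mul_integral_norm_sq_le_one (h : SemicircleSubordinate t μ ν) (ht : 0 ≤ t) {z : ℂ}
    (hz : 0 < z.im) :
    t * ∫ x : ℝ, ‖((x : ℂ) - (z + t * stieltjes μ z))⁻¹‖ ^ 2 ∂ν ≤ 1 := by
  have h1 := stieltjes_im (μ := ν) (offSupport (μ := μ) ht hz)
  have h2 := hz.trans_le (im_le_im_add (μ := μ) ht hz)
  rw [← h z hz] at h1
  by_contra! hI
  have h3 : (z + t * stieltjes μ z).im = z.im + t * (stieltjes μ z).im := by simp
  nlinarith [mul_lt_mul_of_pos_left hI h2]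

theorem mul_im_sq_le_one (h : SemicircleSubordinate t μ ν) (ht : 0 ≤ t) {z : ℂ}
    (hz : 0 < z.im) : t * (stieltjes μ z).im ^ 2 ≤ 1 := by
  rw [h z hz]
  exact (mul_le_mul_of_nonneg_left (sq_stieltjes_im_le (offSupport ht hz)) ht).trans
    (h.mul_integral_norm_sq_le_one ht hz)

/-- The imaginary part of the Stieltjes transform is Hölder continuous of exponent `1/3`. -/
theorem abs_im_sub_im_pow_three_le (h : SemicircleSubordinate t μ ν) (ht : 0 < t) {z₁ z₂ : ℂ}
    (hz₁ : 0 < z₁.im) (hz₂ : 0 < z₂.im) :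
    |(stieltjes μ z₁).im - (stieltjes μ z₂).im| ^ 3 ≤ 6 / t ^ 2 * ‖z₁ - z₂‖ := by
  have key := norm_sub_mul_sq_le ht.le (offSupport (μ := μ) (ν := ν) ht.le hz₁)
    (offSupport (μ := μ) (ν := ν) ht.le hz₂)
    (h.mul_integral_norm_sq_le_one ht.le hz₁) (h.mul_integral_norm_sq_le_one ht.le hz₂)
  rw [← h z₁ hz₁, ← h z₂ hz₂, add_sub_cancel_right, add_sub_cancel_right] at key
  have b1 := h.mul_im_sq_le_one ht.le hz₁
  have b2 := h.mul_im_sq_le_one ht.le hz₂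
  have p1 := stieltjes_im_nonneg (μ := μ) hz₁
  have p2 := stieltjes_im_nonneg (μ := μ) hz₂
  have hw : t * |(stieltjes μ z₁).im - (stieltjes μ z₂).im| - ‖z₁ - z₂‖ ≤
      ‖z₁ + t * stieltjes μ z₁ - (z₂ + t * stieltjes μ z₂)‖ := by
    have e : (t : ℂ) * (stieltjes μ z₁ - stieltjes μ z₂) =
      (z₁ + t * stieltjes μ z₁ - (z₂ + t * stieltjes μ z₂)) - (z₁ - z₂) := by ring
    have n := norm_sub_le (z₁ + t * stieltjes μ z₁ - (z₂ + t * stieltjes μ z₂)) (z₁ - z₂)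
    rw [← e, norm_mul, Complex.norm_real, Real.norm_of_nonneg ht.le] at n
    have := Complex.abs_im_le_norm (stieltjes μ z₁ - stieltjes μ z₂)
    rw [Complex.sub_im] at this
    nlinarith
  generalize ‖z₁ + t * stieltjes μ z₁ - (z₂ + t * stieltjes μ z₂)‖ = W at *
  generalize (stieltjes μ z₁).im = h₁ at *
  generalize (stieltjes μ z₂).im = h₂ at *
  have hd := norm_nonneg (z₁ - z₂)
  generalize ‖z₁ - z₂‖ = d at *
  have hS : |h₁ - h₂| ^ 2 ≤ (h₁ + h₂) ^ 2 := by rw [sq_abs]; nlinarith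
  have hS' : t * (h₁ + h₂) ^ 2 ≤ 4 := by nlinarith [mul_nonneg ht.le (sq_nonneg (h₁ - h₂))]
  -- Multiplied out, `t²/2 · |h₁ - h₂| (h₁ + h₂)² ≤ d + d · t/2 · (h₁ + h₂)² ≤ 3d`; this is where
  -- the 6 comes from. Then `|h₁ - h₂| ≤ h₁ + h₂` turns the left side into a cube.
  have h5 : (t * |h₁ - h₂| - d) * (t / 2 * (h₁ + h₂) ^ 2) ≤ d :=
    (mul_le_mul_of_nonneg_right hw (by positivity)).trans key
  have h6 : t ^ 2 * |h₁ - h₂| * (h₁ + h₂) ^ 2 ≤ 6 * d := by nlinarith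
  have h7 : t ^ 2 * |h₁ - h₂| ^ 3 ≤ 6 * d := by
    refine le_trans ?_ h6
    rw [pow_succ |h₁ - h₂|, mul_comm (_ ^ 2) |h₁ - h₂|, ← mul_assoc]
    gcongr
  rw [div_mul_eq_mul_div, le_div_iff₀ (by positivity)]
  linarith

theorem uniformContinuousOn_im (h : SemicircleSubordinate t μ ν) (ht : 0 < t) :
    UniformContinuousOn (fun z => (stieltjes μ z).im) {z : ℂ | 0 < z.im} := by
  rw [Metric.uniformContinuousOn_iff]
  intro ε hε
  refine ⟨ε ^ 3 * t ^ 2 / 6, by positivity, fun z₁ hz₁ z₂ hz₂ hd => ?_⟩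
  rw [dist_eq_norm] at hd
  rw [Real.dist_eq]
  refine lt_of_pow_lt_pow_left₀ 3 hε.le ((h.abs_im_sub_im_pow_three_le ht hz₁ hz₂).trans_lt ?_)
  rw [div_mul_eq_mul_div, div_lt_iff₀ (by positivity)]
  linarith

theorem exists_tendsto_im (h : SemicircleSubordinate t μ ν) (ht : 0 < t) (x : ℝ) :
    ∃ y, Tendsto (fun z => (stieltjes μ z).im) (𝓝[{z : ℂ | 0 < z.im}] x) (𝓝 y) := by
  have hx : (x : ℂ) ∈ closure {z : ℂ | 0 < z.im} := by
    rw [Complex.closure_setOfPred_lt_im]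
    simp
  have := mem_closure_iff_nhdsWithin_neBot.mp hx
  exact CompleteSpace.complete ((cauchy_nhds.mono' this inf_le_left).map_of_le
    (h.uniformContinuousOn_im ht) inf_le_right)

theorem tendsto_ofReal_add_mul_I (x : ℝ) :
    Tendsto (fun η : ℝ => (x : ℂ) + η * Complex.I) (𝓝[>] 0) (𝓝[{z : ℂ | 0 < z.im}] x) := by
  refine tendsto_nhdsWithin_iff.mpr ⟨?_, ?_⟩
  · refine tendsto_nhdsWithin_of_tendsto_nhds ?_
    have : Continuous fun η : ℝ => (x : ℂ) + η * Complex.I := by fun_prop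
    simpa using this.tendsto 0
  · filter_upwards [self_mem_nhdsWithin] with η hη
    simpa using hη

/-- The imaginary part of the Stieltjes transform has a continuous boundary value. -/
theorem exists_boundary_value (h : SemicircleSubordinate t μ ν) (ht : 0 < t) :
    ∃ f : ℝ → ℝ, Continuous f ∧ ∀ x : ℝ,
      Tendsto (fun η : ℝ => (stieltjes μ (x + η * Complex.I)).im) (𝓝[>] 0) (𝓝 (f x)) := by
  set F := extendFrom {z : ℂ | 0 < z.im} fun z => (stieltjes μ z).im
  have hF : ContinuousOn F (range Complex.ofReal) := by
    refine continuousOn_extendFrom ?_ ?_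
    · rintro _ ⟨x, rfl⟩
      rw [Complex.closure_setOfPred_lt_im]
      simp
    · rintro _ ⟨x, rfl⟩
      exact h.exists_tendsto_im ht x
  refine ⟨fun x => F x, hF.comp_continuous Complex.continuous_ofReal (by simp), fun x => ?_⟩
  exact (tendsto_extendFrom (h.exists_tendsto_im ht x)).comp (tendsto_ofReal_add_mul_I x)

end SemicircleSubordinate

/-! ### Poisson kernel and Stieltjes inversion. -/

/-- The Poisson kernel of the upper half plane, up to the factor `π`. -/
noncomputable def halfPlaneKernel (η x : ℝ) : ℝ := η / (x ^ 2 + η ^ 2)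

theorem im_inv_eq_halfPlaneKernel (u x η : ℝ) :
    (((u : ℂ) - (x + η * Complex.I))⁻¹).im = halfPlaneKernel η (x - u) := by
  rw [Complex.inv_im, Complex.normSq_apply, halfPlaneKernel]
  simp
  ring

theorem halfPlaneKernel_nonneg {η : ℝ} (hη : 0 < η) (x : ℝ) : 0 ≤ halfPlaneKernel η x := by
  rw [halfPlaneKernel]; positivity

theorem halfPlaneKernel_le {η : ℝ} (hη : 0 < η) (x : ℝ) : halfPlaneKernel η x ≤ η⁻¹ := by
  rw [halfPlaneKernel, div_le_iff₀ (by positivity), inv_mul_eq_div, le_div_iff₀ hη]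
  nlinarith [sq_nonneg x]

theorem continuous_halfPlaneKernel {η : ℝ} (hη : 0 < η) : Continuous (halfPlaneKernel η) := by
  unfold halfPlaneKernel
  exact continuous_const.div (by fun_prop) fun x => by positivity

theorem stieltjes_im_eq_integral_halfPlaneKernel (μ : Measure ℝ) [IsFiniteMeasure μ] (x : ℝ)
    {η : ℝ} (hη : 0 < η) :
    (stieltjes μ (x + η * Complex.I)).im = ∫ u, halfPlaneKernel η (x - u) ∂μ := by
  have h : OffSupport μ (x + η * Complex.I) := offSupport_of_im_pos (by simpa using hη)
  simp_rw [← im_inv_eq_halfPlaneKernel]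
  exact (Complex.imCLM.integral_comp_comm h.integrable).symm

/-- The substitution `x = u + η s` moves `η` from the kernel into the argument of `g`, so that
dominated convergence applies as `η → 0`. -/
theorem integral_mul_halfPlaneKernel (g : ℝ → ℝ) (u : ℝ) {η : ℝ} (hη : 0 < η) :
    ∫ x, g x * halfPlaneKernel η (x - u) = ∫ s, g (u + η * s) * (1 + s ^ 2)⁻¹ := by
  rw [← integral_add_right_eq_self (μ := volume) _ u]
  have h := Measure.integral_comp_mul_left
    (fun x => g (x + u) * halfPlaneKernel η (x + u - u)) η
  rw [abs_of_pos (inv_pos.mpr hη), smul_eq_mul, ← div_eq_inv_mul, eq_div_iff hη.ne',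
    ← integral_mul_const] at h
  rw [← h]
  congr 1
  ext s
  rw [halfPlaneKernel]
  field_simp
  ring_nf

theorem abs_integral_mul_halfPlaneKernel_le {g : ℝ → ℝ} {C : ℝ} (hC : ∀ x, |g x| ≤ C) (u : ℝ)
    {η : ℝ} (hη : 0 < η) : |∫ x, g x * halfPlaneKernel η (x - u)| ≤ C * Real.pi := by
  rw [integral_mul_halfPlaneKernel g u hη, ← integral_univ_inv_one_add_sq, ← integral_const_mul,
    ← Real.norm_eq_abs]
  refine norm_integral_le_of_norm_le (integrable_inv_one_add_sq.const_mul C) ?_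
  refine ae_of_all _ fun s => ?_
  rw [norm_mul, Real.norm_of_nonneg (by positivity : 0 ≤ (1 + s ^ 2)⁻¹)]
  exact mul_le_mul_of_nonneg_right (hC _) (by positivity)

theorem tendsto_integral_mul_halfPlaneKernel {g : ℝ → ℝ} (hg : Continuous g) {C : ℝ}
    (hC : ∀ x, |g x| ≤ C) (u : ℝ) :
    Tendsto (fun η => ∫ x, g x * halfPlaneKernel η (x - u)) (𝓝[>] 0) (𝓝 (g u * Real.pi)) := by
  have h : Tendsto (fun η => ∫ s, g (u + η * s) * (1 + s ^ 2)⁻¹) (𝓝[>] 0)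
      (𝓝 (∫ s, g u * (1 + s ^ 2)⁻¹)) := by
    refine tendsto_integral_filter_of_dominated_convergence (fun s => C * (1 + s ^ 2)⁻¹)
      ?_ ?_ (integrable_inv_one_add_sq.const_mul C) ?_
    · refine Eventually.of_forall fun η => Measurable.aestronglyMeasurable ?_
      have := hg.measurable
      fun_prop
    · refine Eventually.of_forall fun η => ae_of_all _ fun s => ?_
      rw [norm_mul, Real.norm_of_nonneg (by positivity : 0 ≤ (1 + s ^ 2)⁻¹)]
      exact mul_le_mul_of_nonneg_right (hC _) (by positivity)
    · refine ae_of_all _ fun s => (Tendsto.mul_const _ ?_)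
      refine tendsto_nhdsWithin_of_tendsto_nhds ?_
      have : Continuous fun η => g (u + η * s) := by fun_prop
      simpa using this.tendsto 0
  rw [integral_const_mul, integral_univ_inv_one_add_sq] at h
  refine h.congr' ?_
  filter_upwards [self_mem_nhdsWithin] with η hη
  exact (integral_mul_halfPlaneKernel g u hη).symm

theorem continuous_stieltjes_ofReal_add (μ : Measure ℝ) [IsFiniteMeasure μ] {η : ℝ}
    (hη : 0 < η) : Continuous fun x : ℝ => stieltjes μ (x + η * Complex.I) := by
  refine continuous_iff_continuousAt.mpr fun x => ?_
  have h : OffSupport μ (x + η * Complex.I) := offSupport_of_im_pos (by simpa using hη)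
  exact ContinuousAt.comp (f := fun x : ℝ => (x : ℂ) + η * Complex.I) h.continuousAt
    (by fun_prop)

theorem integral_mul_stieltjes_im (μ : Measure ℝ) [IsFiniteMeasure μ] {g : ℝ → ℝ}
    (hg : Continuous g) (hgi : Integrable g) {η : ℝ} (hη : 0 < η) :
    ∫ x : ℝ, g x * (stieltjes μ (x + η * Complex.I)).im =
      ∫ u, (∫ x, g x * halfPlaneKernel η (x - u)) ∂μ := by
  simp_rw [stieltjes_im_eq_integral_halfPlaneKernel μ _ hη, ← integral_const_mul]
  refine integral_integral_swap ?_
  refine Integrable.mono' ((hgi.norm.mul_const η⁻¹).comp_fst μ) ?_ ?_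
  · have h1 := (continuous_halfPlaneKernel hη).measurable
    have h2 := hg.measurable
    refine Measurable.aestronglyMeasurable ?_
    simp only [Function.uncurry_def]
    fun_prop
  · refine ae_of_all _ fun p => ?_
    simp only [Function.uncurry]
    rw [norm_mul, Real.norm_of_nonneg (halfPlaneKernel_nonneg hη _)]
    exact mul_le_mul_of_nonneg_left (halfPlaneKernel_le hη _) (norm_nonneg _)

/-- **Stieltjes inversion**: if the imaginary part of the Stieltjes transform is bounded with a
continuous boundary value `f`, then the measure has density `f / π`. -/
theorem eq_withDensity_of_tendsto_stieltjes_im (μ : Measure ℝ) [IsFiniteMeasure μ] {f : ℝ → ℝ}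
    (hf : Continuous f) {B : ℝ} (hB : ∀ z : ℂ, 0 < z.im → (stieltjes μ z).im ≤ B)
    (hlim : ∀ x : ℝ,
      Tendsto (fun η : ℝ => (stieltjes μ (x + η * Complex.I)).im) (𝓝[>] 0) (𝓝 (f x))) :
    μ = volume.withDensity fun x => ENNReal.ofReal (f x / Real.pi) := by
  have hf0 (x : ℝ) : 0 ≤ f x / Real.pi := by
    refine div_nonneg (ge_of_tendsto (hlim x) ?_) Real.pi_pos.le
    filter_upwards [self_mem_nhdsWithin] with η hη
    exact stieltjes_im_nonneg (μ := μ) (by simpa using hη)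
  have hfc : Continuous fun x => f x / Real.pi := by fun_prop
  have : IsLocallyFiniteMeasure (volume.withDensity fun x => ENNReal.ofReal (f x / Real.pi)) :=
    IsLocallyFiniteMeasure.withDensity_ofReal hfc
  refine Measure.ext_of_integral_eq_on_compactlySupported fun g => ?_
  have hg : Continuous g := g.continuous
  have hgi : Integrable g := hg.integrable_of_hasCompactSupport g.hasCompactSupport
  obtain ⟨C, hC⟩ := hg.bounded_above_of_compact_support g.hasCompactSupport
  -- The same integral has two limits: directly it tends to `∫ g f`, and after Fubini, with the
  -- Poisson kernel as an approximate identity, to `π ∫ g dμ`.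
  have h1 : Tendsto (fun η : ℝ => ∫ x : ℝ, g x * (stieltjes μ (x + η * Complex.I)).im) (𝓝[>] 0)
      (𝓝 (∫ x, g x * f x)) := by
    refine tendsto_integral_filter_of_dominated_convergence (fun x => ‖g x‖ * B)
      ?_ ?_ (hgi.norm.mul_const B) (ae_of_all _ fun x => (hlim x).const_mul _)
    · filter_upwards [self_mem_nhdsWithin] with η hη
      have := continuous_stieltjes_ofReal_add μ (mem_Ioi.mp hη)
      exact (hg.mul (Complex.continuous_im.comp this)).aestronglyMeasurable
    · filter_upwards [self_mem_nhdsWithin] with η hη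
      refine ae_of_all _ fun x => ?_
      have hz : 0 < ((x : ℂ) + η * Complex.I).im := by simpa using hη
      rw [norm_mul, Real.norm_of_nonneg (stieltjes_im_nonneg (μ := μ) hz)]
      exact mul_le_mul_of_nonneg_left (hB _ hz) (norm_nonneg _)
  have h2 : Tendsto (fun η : ℝ => ∫ x : ℝ, g x * (stieltjes μ (x + η * Complex.I)).im) (𝓝[>] 0)
      (𝓝 (∫ u, g u * Real.pi ∂μ)) := by
    have : Tendsto (fun η : ℝ => ∫ u, (∫ x, g x * halfPlaneKernel η (x - u)) ∂μ) (𝓝[>] 0)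
        (𝓝 (∫ u, g u * Real.pi ∂μ)) := by
      refine tendsto_integral_filter_of_dominated_convergence (fun _ => C * Real.pi)
        ?_ ?_ (integrable_const _)
        (ae_of_all _ fun u => tendsto_integral_mul_halfPlaneKernel hg hC u)
      · filter_upwards [self_mem_nhdsWithin] with η hη
        have h1 := (continuous_halfPlaneKernel hη).measurable
        have h2 := hg.measurable
        refine (StronglyMeasurable.integral_prod_right
          (f := fun u x => g x * halfPlaneKernel η (x - u)) ?_).aestronglyMeasurable
        refine Measurable.stronglyMeasurable ?_
        simp only [Function.uncurry_def]
        fun_prop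
      · filter_upwards [self_mem_nhdsWithin] with η hη
        exact ae_of_all _ fun u => abs_integral_mul_halfPlaneKernel_le hC u hη
    refine this.congr' ?_
    filter_upwards [self_mem_nhdsWithin] with η hη
    exact (integral_mul_stieltjes_im μ hg hgi hη).symm
  have h3 := tendsto_nhds_unique h2 h1
  rw [integral_mul_const] at h3
  rw [integral_withDensity_eq_integral_toReal_smul (by fun_prop) (by simp),
    eq_div_of_mul_eq Real.pi_ne_zero h3, ← integral_div]
  refine integral_congr_ae (ae_of_all _ fun x => ?_)
  simp only [ENNReal.toReal_ofReal (hf0 x), smul_eq_mul]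
  ring

/-! ### The real axis to the left of the support. -/

theorem notMem_support_of_lt_leftEdge {μ : Measure ℝ} (hμ : IsCompact μ.support) {s : ℝ}
    (hs : s < leftEdge μ) : s ∉ μ.support :=
  fun h => (csInf_le hμ.bddBelow h).not_gt hs

theorem ae_leftEdge_le {μ : Measure ℝ} (hμ : IsCompact μ.support) :
    ∀ᵐ x ∂μ, leftEdge μ ≤ x := by
  filter_upwards [Measure.support_mem_ae (μ := μ)] with x hx
  exact csInf_le hμ.bddBelow hx

/-- The Stieltjes transform of a measure on the real axis. -/
noncomputable def realStieltjes (μ : Measure ℝ) (s : ℝ) : ℝ := ∫ x, (x - s)⁻¹ ∂μ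

theorem stieltjes_ofReal (μ : Measure ℝ) (s : ℝ) : stieltjes μ s = realStieltjes μ s := by
  rw [stieltjes, realStieltjes, ← integral_complex_ofReal]
  simp

section

variable {μ : Measure ℝ} {s s' : ℝ}

theorem realStieltjes_nonneg (hμ : IsCompact μ.support) (hs : s < leftEdge μ) :
    0 ≤ realStieltjes μ s := by
  refine integral_nonneg_of_ae ?_
  filter_upwards [ae_leftEdge_le hμ] with x hx
  exact inv_nonneg.mpr (by linarith)

variable [IsProbabilityMeasure μ]

theorem integrable_inv_sub (hs : s ∉ μ.support) : Integrable (fun x => (x - s)⁻¹) μ := by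
  have := (offSupport_ofReal hs).integrable.re
  simpa only [← Complex.ofReal_sub, ← Complex.ofReal_inv, RCLike.re_to_complex,
    Complex.ofReal_re] using this

theorem realStieltjes_mono (hμ : IsCompact μ.support) (hss' : s ≤ s') (hs' : s' < leftEdge μ) :
    realStieltjes μ s ≤ realStieltjes μ s' := by
  refine integral_mono_ae
    (integrable_inv_sub (notMem_support_of_lt_leftEdge hμ (hss'.trans_lt hs')))
    (integrable_inv_sub (notMem_support_of_lt_leftEdge hμ hs')) ?_
  filter_upwards [ae_leftEdge_le hμ] with x hx
  exact inv_anti₀ (by linarith) (by linarith)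

theorem realStieltjes_le_one (hμ : IsCompact μ.support) (hs : s ≤ leftEdge μ - 1) :
    realStieltjes μ s ≤ 1 := by
  have h := integral_mono_ae (μ := μ) (g := fun _ => (1 : ℝ))
    (integrable_inv_sub (notMem_support_of_lt_leftEdge hμ (by linarith : s < leftEdge μ)))
    (integrable_const _) (by
      filter_upwards [ae_leftEdge_le hμ] with x hx
      exact inv_le_one_of_one_le₀ (by linarith))
  simpa [realStieltjes] using h

theorem continuousOn_realStieltjes (hμ : IsCompact μ.support) :
    ContinuousOn (realStieltjes μ) (Iio (leftEdge μ)) := by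
  intro s hs
  have h := (offSupport_ofReal (notMem_support_of_lt_leftEdge hμ hs)).continuousAt
  have h2 : ContinuousAt (fun s : ℝ => (stieltjes μ s).re) s :=
    Complex.continuous_re.continuousAt.comp
      (ContinuousAt.comp (f := fun s : ℝ => (s : ℂ)) h Complex.continuous_ofReal.continuousAt)
  simp_rw [stieltjes_ofReal, Complex.ofReal_re] at h2
  exact h2.continuousWithinAt

end

/-! ### Subordination to the left of the edge and the square root bound. -/

/-- A measure for which small balls around each point of an interval have mass quadratic in the
radius does not charge the interval. -/
theorem measureReal_Icc_eq_zero {ν : Measure ℝ} [IsFiniteMeasure ν] {p q C : ℝ} (hpq : p < q)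
    (h : ∀ σ ∈ Icc p q, ∀ r > 0, ν.real (Metric.closedBall σ r) ≤ C * r ^ 2) :
    ν.real (Icc p q) = 0 := by
  -- Cover by `N + 1` balls of radius `d = (q - p)/(N + 1)`: the total mass is at most `(N + 1) C
  -- d²`, which tends to zero.
  have key (N : ℕ) : ν.real (Icc p q) ≤ C * (q - p) ^ 2 * (1 / ((N : ℝ) + 1)) := by
    have hN : (0 : ℝ) < N + 1 := by positivity
    set d := (q - p) / (N + 1) with hd
    have hd0 : 0 < d := div_pos (by linarith) hN
    have hNd : (N + 1) * d = q - p := by rw [hd]; field_simp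
    have hsub : Icc p q ⊆ ⋃ k ∈ Finset.range (N + 1), Metric.closedBall (p + k * d) d := by
      intro x hx
      simp only [Finset.mem_range, mem_iUnion, exists_prop, Metric.mem_closedBall, Real.dist_eq]
      have hx0 : 0 ≤ (x - p) / d := div_nonneg (by linarith [hx.1]) hd0.le
      have hfl := Nat.floor_le hx0
      have hlt := Nat.lt_floor_add_one ((x - p) / d)
      rw [le_div_iff₀ hd0] at hfl
      rw [div_lt_iff₀ hd0] at hlt
      by_cases hk : ⌊(x - p) / d⌋₊ < N + 1
      · refine ⟨_, hk, ?_⟩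
        rw [abs_le]
        constructor <;> nlinarith
      -- Only `x = q` lands here; the last ball is centred at `q - d` and still reaches it.
      · refine ⟨N, by omega, ?_⟩
        have : ((N : ℝ) + 1) ≤ ⌊(x - p) / d⌋₊ := by exact_mod_cast not_lt.mp hk
        have := mul_le_mul_of_nonneg_right this hd0.le
        rw [abs_le]
        constructor <;> nlinarith [hx.1, hx.2]
    calc ν.real (Icc p q)
        ≤ ∑ k ∈ Finset.range (N + 1), ν.real (Metric.closedBall (p + k * d) d) :=
          (measureReal_mono hsub (measure_ne_top _ _)).trans (measureReal_biUnion_finset_le _ _)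
      _ ≤ ∑ k ∈ Finset.range (N + 1), C * d ^ 2 := by
          refine Finset.sum_le_sum fun k hk => h _ ⟨?_, ?_⟩ d hd0
          · nlinarith [k.cast_nonneg (α := ℝ)]
          · have : (k : ℝ) ≤ N + 1 := by exact_mod_cast (Finset.mem_range.mp hk).le
            nlinarith [mul_le_mul_of_nonneg_right this hd0.le]
      _ = C * (q - p) ^ 2 * (1 / ((N : ℝ) + 1)) := by
          rw [Finset.sum_const, Finset.card_range, nsmul_eq_mul, hd]
          push_cast
          field_simp
  refine le_antisymm ?_ measureReal_nonneg
  have := tendsto_one_div_add_atTop_nhds_zero_nat (𝕜 := ℝ)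
  refine ge_of_tendsto' (by simpa using this.const_mul (C * (q - p) ^ 2)) key

namespace SemicircleSubordinate

variable {t : ℝ} {μ ν : Measure ℝ} [IsProbabilityMeasure μ] [IsProbabilityMeasure ν]

theorem tendsto_add_mul_stieltjes {s : ℝ} (hs : s ∉ μ.support) :
    Tendsto (fun z : ℂ => z + t * stieltjes μ z) (𝓝[{z : ℂ | 0 < z.im}] s)
      (𝓝 ((s + t * realStieltjes μ s : ℝ) : ℂ)) := by
  have h := (offSupport_ofReal hs).continuousAt.tendsto.mono_left
    (nhdsWithin_le_nhds (s := {z : ℂ | 0 < z.im}))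
  have h2 : Tendsto (fun z : ℂ => z) (𝓝[{z : ℂ | 0 < z.im}] s) (𝓝 s) := nhdsWithin_le_nhds
  push_cast
  rw [← stieltjes_ofReal]
  exact h2.add (h.const_mul _)

theorem nhdsWithin_neBot (s : ℝ) : (𝓝[{z : ℂ | 0 < z.im}] (s : ℂ)).NeBot := by
  refine mem_closure_iff_nhdsWithin_neBot.mp ?_
  rw [Complex.closure_setOfPred_lt_im]
  simp

/-- A Chebyshev bound: on the ball, `|x - w| ≤ r + |σ - w|`, so `t ∫ |x - w|⁻² dν ≤ 1` gives
`ν(ball) ≤ (r + |σ - w|)²/t`. As `z → s` from above, `w → σ`. -/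
theorem measureReal_closedBall_le (h : SemicircleSubordinate t μ ν) (ht : 0 < t) {s : ℝ}
    (hs : s ∉ μ.support) {r : ℝ} (hr : 0 < r) :
    ν.real (Metric.closedBall (s + t * realStieltjes μ s) r) ≤ t⁻¹ * r ^ 2 := by
  set σ := s + t * realStieltjes μ s
  have := nhdsWithin_neBot s
  have hw : Tendsto (fun z : ℂ => z + t * stieltjes μ z) (𝓝[{z : ℂ | 0 < z.im}] s) (𝓝 (σ : ℂ)) :=
    tendsto_add_mul_stieltjes hs
  have hlim : Tendsto (fun z : ℂ => t⁻¹ * (r + ‖(σ : ℂ) - (z + t * stieltjes μ z)‖) ^ 2)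
      (𝓝[{z : ℂ | 0 < z.im}] s) (𝓝 (t⁻¹ * r ^ 2)) := by
    simpa only [sub_self, norm_zero, add_zero] using
      (((hw.const_sub (σ : ℂ)).norm.const_add r).pow 2).const_mul t⁻¹
  refine ge_of_tendsto hlim ?_
  filter_upwards [self_mem_nhdsWithin] with z hz
  have hI := h.mul_integral_norm_sq_le_one ht.le hz
  have hoff := offSupport (μ := μ) (ν := ν) ht.le hz
  have hwim := hz.trans_le (im_le_im_add (μ := μ) ht.le hz)
  generalize z + t * stieltjes μ z = w at *
  have hr' : 0 < r + ‖(σ : ℂ) - w‖ := by positivity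
  have hle : ((r + ‖(σ : ℂ) - w‖) ^ 2)⁻¹ * ν.real (Metric.closedBall σ r) ≤
      ∫ x : ℝ, ‖((x : ℂ) - w)⁻¹‖ ^ 2 ∂ν := by
    rw [mul_comm, ← smul_eq_mul, ← setIntegral_const]
    refine (setIntegral_mono_on (integrableOn_const (by finiteness))
      hoff.integrable_norm_sq.integrableOn Metric.isClosed_closedBall.measurableSet
      fun x hx => ?_).trans
      (setIntegral_le_integral hoff.integrable_norm_sq (ae_of_all _ fun x => by positivity))
    rw [norm_inv, inv_pow]
    have hx0 : (0 : ℝ) < ‖(x : ℂ) - w‖ := by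
      rw [norm_pos_iff]
      intro h0
      have := congrArg Complex.im h0
      simp at this
      linarith
    refine inv_anti₀ (by positivity) ?_
    gcongr
    have hxσ : ‖(x : ℂ) - σ‖ ≤ r := by
      rw [← Complex.ofReal_sub, Complex.norm_real]
      exact hx
    calc ‖(x : ℂ) - w‖ = ‖((x : ℂ) - σ) + (σ - w)‖ := by ring_nf
      _ ≤ _ := (norm_add_le _ _).trans (by gcongr)
  rw [inv_mul_le_iff₀ (by positivity)] at hle
  rw [inv_mul_eq_div, le_div_iff₀ ht]
  nlinarith [mul_le_mul_of_nonneg_left hI (sq_nonneg (r + ‖(σ : ℂ) - w‖))]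

/-- Far to the left, `σ(s) = s + t m(s)` is below the edge of `ν`. If it passed the edge, its
intermediate values would fill an interval around it on which small balls have quadratically small
mass. That interval would be null for `ν`, although the edge belongs to the support. -/
theorem add_mul_realStieltjes_le_leftEdge (h : SemicircleSubordinate t μ ν) (ht : 0 < t)
    (hμ : IsCompact μ.support) (hν : IsCompact ν.support) {s : ℝ} (hs : s < leftEdge μ) :
    s + t * realStieltjes μ s ≤ leftEdge ν := by
  by_contra! hlt
  set W : ℝ → ℝ := fun s => s + t * realStieltjes μ s
  -- The second entry makes `m(s₀) ≤ 1`, and then the third makes `σ(s₀) ≤ s₀ + t` smaller than the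
  -- edge of `ν`.
  set s₀ := min (s - 1) (min (leftEdge μ - 1) (leftEdge ν - t - 1))
  have hs₀ : s₀ ≤ s := (min_le_left _ _).trans (by linarith)
  have hs₁ : s₀ ≤ leftEdge μ - 1 := (min_le_right _ _).trans (min_le_left _ _)
  have hs₂ : s₀ ≤ leftEdge ν - t - 1 := (min_le_right _ _).trans (min_le_right _ _)
  have hW₀ : W s₀ < leftEdge ν := by
    have := realStieltjes_le_one hμ hs₁
    simp only [W]
    nlinarith
  have hWc : ContinuousOn W (Icc s₀ s) :=
    (continuousOn_id.add (continuousOn_const.mul (continuousOn_realStieltjes hμ))).mono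
      fun x hx => hx.2.trans_lt hs
  have hz : ν.real (Icc (W s₀) (W s)) = 0 := by
    refine measureReal_Icc_eq_zero (C := t⁻¹) (hW₀.trans hlt) fun σ hσ r hr => ?_
    obtain ⟨s', hs', rfl⟩ := intermediate_value_Icc hs₀ hWc hσ
    exact h.measureReal_closedBall_le ht
      (notMem_support_of_lt_leftEdge hμ (hs'.2.trans_lt hs)) hr
  have hmem : leftEdge ν ∈ ν.support :=
    hν.sInf_mem (Measure.nonempty_support (IsProbabilityMeasure.ne_zero ν))
  have hpos := (Measure.mem_support_iff_forall _).mp hmem _ (Icc_mem_nhds hW₀ hlt)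
  rw [measureReal_eq_zero_iff] at hz
  exact hpos.ne' hz

/-- Strictness is free because `s ↦ s + t m(s)` is strictly increasing and `s` can be moved slightly
to the right. It makes `m_ν` continuous at `σ`. -/
theorem add_mul_realStieltjes_lt_leftEdge (h : SemicircleSubordinate t μ ν) (ht : 0 < t)
    (hμ : IsCompact μ.support) (hν : IsCompact ν.support) {s : ℝ} (hs : s < leftEdge μ) :
    s + t * realStieltjes μ s < leftEdge ν := by
  obtain ⟨s', hs', hs''⟩ := exists_between hs
  have h1 := h.add_mul_realStieltjes_le_leftEdge ht hμ hν hs''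
  have h2 := mul_le_mul_of_nonneg_left (realStieltjes_mono hμ hs'.le hs'') ht.le
  linarith

theorem realStieltjes_eq (h : SemicircleSubordinate t μ ν) (ht : 0 < t)
    (hμ : IsCompact μ.support) (hν : IsCompact ν.support) {s : ℝ} (hs : s < leftEdge μ) :
    stieltjes μ s = stieltjes ν ((s + t * realStieltjes μ s : ℝ) : ℂ) := by
  have := nhdsWithin_neBot s
  have hs' := notMem_support_of_lt_leftEdge hμ hs
  have h1 := (offSupport_ofReal hs').continuousAt.tendsto.mono_left
    (nhdsWithin_le_nhds (s := {z : ℂ | 0 < z.im}))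
  have h2 := (offSupport_ofReal (notMem_support_of_lt_leftEdge hν
    (h.add_mul_realStieltjes_lt_leftEdge ht hμ hν hs))).continuousAt.tendsto.comp
    (tendsto_add_mul_stieltjes (t := t) hs')
  refine tendsto_nhds_unique h1 (h2.congr' ?_)
  filter_upwards [self_mem_nhdsWithin] with z hz
  exact (h z hz).symm

/-- Comparison of a point of the upper half plane with a point to the left of the support. -/
theorem sq_mul_im_sq_le (h : SemicircleSubordinate t μ ν) (ht : 0 < t)
    (hμ : IsCompact μ.support) (hν : IsCompact ν.support) {s K : ℝ} (hs : s < leftEdge μ)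
    (hK : ∀ x ∈ ν.support, x - s ≤ K) {z : ℂ} (hz : 0 < z.im) :
    t ^ 2 * (stieltjes μ z).im ^ 2 ≤ K * ‖z - s‖ := by
  set σ := s + t * realStieltjes μ s
  have hσ : σ < leftEdge ν := h.add_mul_realStieltjes_lt_leftEdge ht hμ hν hs
  have hsσ : s ≤ σ := by
    have := mul_nonneg ht.le (realStieltjes_nonneg hμ hs)
    simp only [σ]; linarith
  have hσoff : OffSupport ν σ := offSupport_ofReal (notMem_support_of_lt_leftEdge hν hσ)
  have hoff := offSupport (μ := μ) (ν := ν) ht.le hz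
  have hwim := hz.trans_le (im_le_im_add (μ := μ) ht.le hz)
  have hwim' : t * (stieltjes μ z).im ≤ (z + t * stieltjes μ z).im := by simp [hz.le]
  have him : (stieltjes μ z).im = (z + t * stieltjes μ z).im *
      ∫ x : ℝ, ‖((x : ℂ) - (z + t * stieltjes μ z))⁻¹‖ ^ 2 ∂ν := by
    rw [← stieltjes_im hoff, ← h z hz]
  have hnn := stieltjes_im_nonneg (μ := μ) hz
  have hsub := stieltjes_sub hoff hσoff
  rw [← h z hz, ← h.realStieltjes_eq ht hμ hν hs] at hsub
  -- Resolvent identity for `m_ν` at `w` and `σ`, inserted into `z - s = (w - σ) - t (m(z) - m(s))`.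
  have hfac : z - s = (z + t * stieltjes μ z - σ) *
      (1 - t * ∫ x : ℝ, ((x : ℂ) - (z + t * stieltjes μ z))⁻¹ * ((x : ℂ) - σ)⁻¹ ∂ν) := by
    have hσ' : (σ : ℂ) = s + t * stieltjes μ s := by simp [σ, stieltjes_ofReal]
    linear_combination (-t : ℂ) * hsub + hσ'
  generalize z + t * stieltjes μ z = w at *
  have hKpos : 0 < K := by
    obtain ⟨x, hx⟩ := Measure.nonempty_support (IsProbabilityMeasure.ne_zero ν)
    have := csInf_le hν.bddBelow hx
    have := hK x hx
    have : leftEdge ν ≤ x := csInf_le hν.bddBelow hx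
    linarith
  -- Since `s ≤ σ`, on the support `0 < x - σ ≤ x - s ≤ K`, so the real factor `K (x - σ)⁻¹` is at
  -- least 1. This bounds the second factor of `hfac` from below through its imaginary part; for the
  -- first, `|w - σ| ≥ Im w ≥ t Im m(z)`.
  have himab : (stieltjes μ z).im ≤
      K * (∫ x : ℝ, ((x : ℂ) - w)⁻¹ * ((x : ℂ) - σ)⁻¹ ∂ν).im := by
    have e : (∫ x : ℝ, ((x : ℂ) - w)⁻¹ * ((x : ℂ) - σ)⁻¹ ∂ν).im =
        ∫ x : ℝ, (((x : ℂ) - w)⁻¹ * ((x : ℂ) - σ)⁻¹).im ∂ν :=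
      (Complex.imCLM.integral_comp_comm (hoff.integrable_mul hσoff)).symm
    rw [him, e, ← integral_const_mul, ← integral_const_mul]
    refine integral_mono_ae (hoff.integrable_norm_sq.const_mul _)
      ((hoff.integrable_mul hσoff).im.const_mul K) ?_
    filter_upwards [Measure.support_mem_ae (μ := ν)] with x hx
    have hx1 : leftEdge ν ≤ x := csInf_le hν.bddBelow hx
    have hx2 := hK x hx
    have e2 : (((x : ℂ) - w)⁻¹ * ((x : ℂ) - σ)⁻¹).im =
        (w.im * ‖((x : ℂ) - w)⁻¹‖ ^ 2) * (x - σ)⁻¹ := by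
      rw [← im_inv_ofReal_sub, ← Complex.ofReal_sub, ← Complex.ofReal_inv, Complex.im_mul_ofReal]
    simp only [e2]
    have hpos : 0 < x - σ := by linarith
    have : 1 ≤ K * (x - σ)⁻¹ := by
      rw [← div_eq_mul_inv, le_div_iff₀ hpos]
      linarith
    calc w.im * ‖((x : ℂ) - w)⁻¹‖ ^ 2 = (w.im * ‖((x : ℂ) - w)⁻¹‖ ^ 2) * 1 := by ring
      _ ≤ (w.im * ‖((x : ℂ) - w)⁻¹‖ ^ 2) * (K * (x - σ)⁻¹) := by gcongr
      _ = _ := by ring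
  have n1 : w.im ≤ ‖w - σ‖ := by simpa using Complex.im_le_norm (w - σ)
  have n2 : t * (∫ x : ℝ, ((x : ℂ) - w)⁻¹ * ((x : ℂ) - σ)⁻¹ ∂ν).im ≤
      ‖1 - t * ∫ x : ℝ, ((x : ℂ) - w)⁻¹ * ((x : ℂ) - σ)⁻¹ ∂ν‖ := by
    have := (neg_le_abs _).trans (Complex.abs_im_le_norm
      (1 - t * ∫ x : ℝ, ((x : ℂ) - w)⁻¹ * ((x : ℂ) - σ)⁻¹ ∂ν))
    simpa using this
  rw [hfac, norm_mul]
  calc t ^ 2 * (stieltjes μ z).im ^ 2 = (t * (stieltjes μ z).im) * (t * (stieltjes μ z).im) := by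
        ring
    _ ≤ ‖w - σ‖ * (t * (K * (∫ x : ℝ, ((x : ℂ) - w)⁻¹ * ((x : ℂ) - σ)⁻¹ ∂ν).im)) := by
        exact mul_le_mul (hwim'.trans n1) (by gcongr) (by positivity) (norm_nonneg _)
    _ ≤ ‖w - σ‖ * (K * ‖1 - t * ∫ x : ℝ, ((x : ℂ) - w)⁻¹ * ((x : ℂ) - σ)⁻¹ ∂ν‖) := by
        rw [mul_left_comm t K]
        gcongr
    _ = _ := by ring

/-- The square root bound for the boundary value at the left edge. -/
theorem exists_boundary_le_sqrt (h : SemicircleSubordinate t μ ν) (ht : 0 < t)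
    (hμ : IsCompact μ.support) (hν : IsCompact ν.support) {f : ℝ → ℝ}
    (hf : ∀ x : ℝ,
      Tendsto (fun η : ℝ => (stieltjes μ (x + η * Complex.I)).im) (𝓝[>] 0) (𝓝 (f x))) :
    ∃ c, 0 < c ∧ ∀ x, leftEdge μ ≤ x → f x ≤ c * Real.sqrt (x - leftEdge μ) := by
  obtain ⟨L, hL⟩ := hν.bddAbove
  -- One constant for all `s` within distance 1 of the edge, so that it survives `s → leftEdge μ`.
  set K := |L - (leftEdge μ - 1)| + 1
  have hK0 : 0 < K := by positivity
  refine ⟨Real.sqrt (K / t ^ 2), by positivity, fun x hx => ?_⟩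
  have key (s : ℝ) (hs : s ∈ Ioo (leftEdge μ - 1) (leftEdge μ)) :
      t ^ 2 * f x ^ 2 ≤ K * |x - s| := by
    have h1 : Tendsto (fun η : ℝ => K * ‖(x : ℂ) + η * Complex.I - s‖) (𝓝[>] 0)
        (𝓝 (K * |x - s|)) := by
      refine tendsto_nhdsWithin_of_tendsto_nhds ?_
      have : Continuous fun η : ℝ => K * ‖(x : ℂ) + η * Complex.I - s‖ := by fun_prop
      have h0 := this.tendsto 0
      simpa [← Complex.ofReal_sub] using h0
    refine le_of_tendsto_of_tendsto (((hf x).pow 2).const_mul _) h1 ?_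
    filter_upwards [self_mem_nhdsWithin] with η hη
    refine h.sq_mul_im_sq_le ht hμ hν hs.2 (fun y hy => ?_) (by simpa using hη)
    have := hL hy
    have := le_abs_self (L - (leftEdge μ - 1))
    simp only [K]
    linarith [hs.1]
  have hlim : Tendsto (fun s => K * |x - s|) (𝓝[<] leftEdge μ) (𝓝 (K * |x - leftEdge μ|)) := by
    refine tendsto_nhdsWithin_of_tendsto_nhds ?_
    have : Continuous fun s => K * |x - s| := by fun_prop
    exact this.tendsto _
  have hfin : t ^ 2 * f x ^ 2 ≤ K * |x - leftEdge μ| := by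
    refine ge_of_tendsto hlim ?_
    filter_upwards [Ioo_mem_nhdsLT (by linarith : leftEdge μ - 1 < leftEdge μ)] with s hs
    exact key s hs
  rw [abs_of_nonneg (by linarith)] at hfin
  rw [← Real.sqrt_mul (by positivity)]
  refine Real.le_sqrt_of_sq_le ?_
  rw [div_mul_eq_mul_div, le_div_iff₀ (by positivity)]
  linarith

end SemicircleSubordinate

/-! ### The density and its edge bound. -/

theorem SemicircleSubordinate.exists_density {t : ℝ} {μ ν : Measure ℝ} [IsProbabilityMeasure μ]
    [IsProbabilityMeasure ν] (h : SemicircleSubordinate t μ ν) (ht : 0 < t)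
    (hμ : IsCompact μ.support) (hν : IsCompact ν.support) :
    ∃ f : ℝ → ℝ, Continuous f ∧ (∀ x, 0 ≤ f x) ∧
      μ = volume.withDensity (fun x => ENNReal.ofReal (f x)) ∧
      ∃ c ε : ℝ, 0 < c ∧ 0 < ε ∧
        ∀ x ∈ Set.Icc (leftEdge μ) (leftEdge μ + ε), f x ≤ c * Real.sqrt (x - leftEdge μ) := by
  obtain ⟨f, hfc, hf⟩ := h.exists_boundary_value ht
  obtain ⟨c, hc, hfle⟩ := h.exists_boundary_le_sqrt ht hμ hν hf
  -- The bound holds on the whole half-line, so `ε = 1` is an arbitrary choice.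
  refine ⟨fun x => f x / Real.pi, by fun_prop, fun x => ?_, ?_, c / Real.pi, 1,
    div_pos hc Real.pi_pos, one_pos, fun x hx => ?_⟩
  · refine div_nonneg (ge_of_tendsto (hf x) ?_) Real.pi_pos.le
    filter_upwards [self_mem_nhdsWithin] with η hη
    exact stieltjes_im_nonneg (μ := μ) (by simpa using hη)
  · refine eq_withDensity_of_tendsto_stieltjes_im μ hfc (B := Real.sqrt t⁻¹) (fun z hz => ?_) hf
    refine Real.le_sqrt_of_sq_le ?_
    rw [inv_eq_one_div, le_div_iff₀ ht, mul_comm]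
    exact h.mul_im_sq_le_one ht.le hz
  · rw [div_mul_eq_mul_div]
    exact div_le_div_of_nonneg_right (hfle x hx.1) Real.pi_pos.le

/-! ### The Cauchy transform of the semicircle law. -/

theorem one_sub_two_mul_cos_add_sq (q : ℂ) (θ : ℝ) :
    1 - 2 * q * Real.cos θ + q ^ 2 =
      (1 - q * Complex.exp (-θ * Complex.I)) * (1 - q * Complex.exp (θ * Complex.I)) := by
  have h : Complex.exp (-θ * Complex.I) * Complex.exp (θ * Complex.I) = 1 := by
    rw [← Complex.exp_add]; simp
  rw [Complex.ofReal_cos, Complex.cos]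
  linear_combination (-q ^ 2) * h

theorem norm_mul_exp_lt {q : ℂ} (hq : ‖q‖ < 1) (θ : ℝ) :
    ‖q * Complex.exp (θ * Complex.I)‖ < 1 ∧ ‖q * Complex.exp (-θ * Complex.I)‖ < 1 := by
  have h := Complex.norm_exp_ofReal_mul_I (-θ)
  push_cast at h
  rw [norm_mul, norm_mul, Complex.norm_exp_ofReal_mul_I, h]
  simpa using hq

theorem one_sub_ne_zero_of_norm_lt {x : ℂ} (hx : ‖x‖ < 1) : 1 - x ≠ 0 := by
  intro h
  rw [← sub_eq_zero.mp h] at hx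
  simp at hx

theorem one_sub_two_mul_cos_add_sq_ne_zero {q : ℂ} (hq : ‖q‖ < 1) (θ : ℝ) :
    1 - 2 * q * Real.cos θ + q ^ 2 ≠ 0 := by
  rw [one_sub_two_mul_cos_add_sq]
  exact mul_ne_zero (one_sub_ne_zero_of_norm_lt (norm_mul_exp_lt hq θ).2)
    (one_sub_ne_zero_of_norm_lt (norm_mul_exp_lt hq θ).1)

/-- The generating function of the Chebyshev polynomials of the second kind. -/
theorem hasSum_pow_mul_sin {q : ℂ} (hq : ‖q‖ < 1) (θ : ℝ) :
    HasSum (fun n : ℕ => q ^ n * (Real.sin ((n + 1) * θ) : ℂ))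
      (Real.sin θ * (1 - 2 * q * Real.cos θ + q ^ 2)⁻¹) := by
  obtain ⟨h1, h2⟩ := norm_mul_exp_lt hq θ
  have s := (((hasSum_geometric_of_norm_lt_one h2).mul_left
    (Complex.exp (-θ * Complex.I))).sub ((hasSum_geometric_of_norm_lt_one h1).mul_left
    (Complex.exp (θ * Complex.I)))).mul_left (Complex.I / 2)
  have e1 : (Real.sin θ : ℂ) * (1 - 2 * q * Real.cos θ + q ^ 2)⁻¹ = Complex.I / 2 *
      (Complex.exp (-θ * Complex.I) * (1 - q * Complex.exp (-θ * Complex.I))⁻¹ -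
        Complex.exp (θ * Complex.I) * (1 - q * Complex.exp (θ * Complex.I))⁻¹) := by
    rw [one_sub_two_mul_cos_add_sq]
    have h3 := one_sub_ne_zero_of_norm_lt h1
    have h4 := one_sub_ne_zero_of_norm_lt h2
    rw [Complex.ofReal_sin, Complex.sin]
    generalize Complex.exp (θ * Complex.I) = E at *
    generalize Complex.exp (-θ * Complex.I) = E' at *
    rw [mul_inv]
    linear_combination Complex.I / 2 * E' * (1 - q * E')⁻¹ * mul_inv_cancel₀ h3 -
      Complex.I / 2 * E * (1 - q * E)⁻¹ * mul_inv_cancel₀ h4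
  rw [e1]
  refine (congrArg (HasSum · _) (funext fun n => ?_)).mpr s
  rw [Complex.ofReal_sin, Complex.sin]
  push_cast
  rw [show -(((n : ℂ) + 1) * θ) * Complex.I = ((n + 1 : ℕ) : ℂ) * (-θ * Complex.I) by
    push_cast; ring, show ((n : ℂ) + 1) * θ * Complex.I = ((n + 1 : ℕ) : ℂ) * (θ * Complex.I) by
    push_cast; ring, Complex.exp_nat_mul, Complex.exp_nat_mul]
  ring

theorem integral_cos_natCast_mul {k : ℕ} (hk : k ≠ 0) :
    ∫ θ in (0 : ℝ)..Real.pi, Real.cos (k * θ) = 0 := by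
  have hk' : (k : ℝ) ≠ 0 := Nat.cast_ne_zero.mpr hk
  rw [intervalIntegral.integral_comp_mul_left _ hk', integral_cos, Real.sin_nat_mul_pi]
  simp

theorem integral_sin_mul_sin_natCast (n : ℕ) :
    ∫ θ in (0 : ℝ)..Real.pi, Real.sin θ * Real.sin ((n + 1) * θ) =
      if n = 0 then Real.pi / 2 else 0 := by
  have h (θ : ℝ) : Real.sin θ * Real.sin ((n + 1) * θ) =
      (Real.cos (n * θ) - Real.cos ((n + 2 : ℕ) * θ)) / 2 := by
    have e1 : (n : ℝ) * θ = (n + 1) * θ - θ := by ring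
    have e2 : ((n + 2 : ℕ) : ℝ) * θ = (n + 1) * θ + θ := by push_cast; ring
    rw [e1, e2, Real.cos_sub, Real.cos_add]
    ring
  simp_rw [h]
  rw [intervalIntegral.integral_div, intervalIntegral.integral_sub
    (Continuous.intervalIntegrable (by fun_prop) _ _)
    (Continuous.intervalIntegrable (by fun_prop) _ _),
    integral_cos_natCast_mul (k := n + 2) (by omega)]
  split_ifs with hn
  · simp [hn]
  · rw [integral_cos_natCast_mul hn]
    simp

/-- Expand in powers of `q`: the coefficients are `sin ((n + 1) θ)`, and orthogonality to `sin θ`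
leaves only `n = 0`. -/
theorem integral_sin_sq_mul_inv {q : ℂ} (hq : ‖q‖ < 1) :
    ∫ θ in (0 : ℝ)..Real.pi,
      (Real.sin θ : ℂ) * (Real.sin θ * (1 - 2 * q * Real.cos θ + q ^ 2)⁻¹) =
      (Real.pi / 2 : ℝ) := by
  have h := intervalIntegral.hasSum_integral_of_dominated_convergence (μ := volume)
    (a := 0) (b := Real.pi)
    (F := fun (n : ℕ) (θ : ℝ) => (Real.sin θ : ℂ) * (q ^ n * (Real.sin ((n + 1) * θ) : ℂ)))
    (f := fun θ => (Real.sin θ : ℂ) * (Real.sin θ * (1 - 2 * q * Real.cos θ + q ^ 2)⁻¹))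
    (fun n _ => ‖q‖ ^ n) (fun n => Continuous.aestronglyMeasurable (by fun_prop))
    (fun n => ae_of_all _ fun θ _ => by
      rw [norm_mul, norm_mul, norm_pow, Complex.norm_real, Complex.norm_real, Real.norm_eq_abs,
        Real.norm_eq_abs]
      have h1 := Real.abs_sin_le_one θ
      have h2 := Real.abs_sin_le_one ((n + 1) * θ)
      have h3 : 0 ≤ ‖q‖ ^ n := by positivity
      calc _ ≤ 1 * (‖q‖ ^ n * 1) := by gcongr
        _ = _ := by ring)
    (ae_of_all _ fun θ _ => summable_geometric_of_lt_one (norm_nonneg q) hq)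
    (by simp)
    (ae_of_all _ fun θ _ => (hasSum_pow_mul_sin hq θ).mul_left _)
  have h2 (n : ℕ) : ∫ θ in (0 : ℝ)..Real.pi,
      (Real.sin θ : ℂ) * (q ^ n * (Real.sin ((n + 1) * θ) : ℂ)) =
      if n = 0 then ((Real.pi / 2 : ℝ) : ℂ) else 0 := by
    simp_rw [mul_left_comm _ (q ^ n)]
    rw [intervalIntegral.integral_const_mul]
    simp_rw [← Complex.ofReal_mul]
    rw [intervalIntegral.integral_ofReal, integral_sin_mul_sin_natCast]
    split_ifs with hn <;> simp [hn]
  simp_rw [h2] at h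
  exact h.unique (hasSum_ite_eq 0 _)

/-- The Stieltjes transform of the semicircle law, in the parametrization that makes it rational. -/
theorem integral_semicircleLaw_inv {t : ℝ} (ht : 0 < t) {g : ℂ}
    (hg : ‖(Real.sqrt t : ℂ) * g‖ < 1) :
    ∫ x : ℝ, (1 + t * g ^ 2 - g * x)⁻¹ ∂(semicircleLaw t) = 1 := by
  set r := Real.sqrt t
  have hr : 0 < r := Real.sqrt_pos.mpr ht
  have hrt : r ^ 2 = t := Real.sq_sqrt ht.le
  have hrtC : (r : ℂ) ^ 2 = t := by exact_mod_cast hrt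
  set G : ℝ → ℂ := fun x =>
    (Real.sqrt (4 * t - x ^ 2) / (2 * Real.pi * t)) • (1 + t * g ^ 2 - g * x)⁻¹
  have e1 : ∫ x : ℝ, (1 + t * g ^ 2 - g * x)⁻¹ ∂(semicircleLaw t) = ∫ x, G x := by
    rw [semicircleLaw, integral_withDensity_eq_integral_toReal_smul (by fun_prop) (by simp)]
    refine integral_congr_ae (ae_of_all _ fun x => ?_)
    simp only [G]
    rw [ENNReal.toReal_ofReal (by positivity)]
  have e2 : ∫ x, G x = ∫ x in (-(2 * r))..(2 * r), G x := by
    rw [intervalIntegral.integral_of_le (by linarith),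
      setIntegral_eq_integral_of_forall_compl_eq_zero]
    intro x hx
    have : 4 * t - x ^ 2 ≤ 0 := by
      by_contra! h
      refine hx ⟨?_, ?_⟩
      · nlinarith
      · nlinarith
    simp [G, Real.sqrt_eq_zero_of_nonpos this]
  -- With `x = 2√t cos θ` and `q = √t g` the denominator becomes the Chebyshev one, and the
  -- semicircle density together with `dx` contributes `sin² θ`.
  have hden (θ : ℝ) : 1 + (t : ℂ) * g ^ 2 - g * ((2 * r * Real.cos θ : ℝ) : ℂ) =
      1 - 2 * (r * g) * Real.cos θ + (r * g) ^ 2 := by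
    push_cast
    linear_combination (-g ^ 2) * hrtC
  have hcont : ContinuousOn G ((fun θ => 2 * r * Real.cos θ) '' uIcc 0 Real.pi) := by
    rintro _ ⟨θ, -, rfl⟩
    have h0 : 1 + (t : ℂ) * g ^ 2 - g * ((2 * r * Real.cos θ : ℝ) : ℂ) ≠ 0 := by
      rw [hden]
      exact one_sub_two_mul_cos_add_sq_ne_zero hg θ
    refine ContinuousAt.continuousWithinAt ?_
    refine ContinuousAt.smul
      (f := fun x : ℝ => Real.sqrt (4 * t - x ^ 2) / (2 * Real.pi * t)) (by fun_prop)
      (ContinuousAt.inv₀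
      (f := fun x : ℝ => 1 + (t : ℂ) * g ^ 2 - g * (x : ℂ)) (by fun_prop) h0)
  have e3 := intervalIntegral.integral_deriv_smul_comp' (a := 0) (b := Real.pi)
    (f := fun θ => 2 * r * Real.cos θ) (f' := fun θ => 2 * r * (-Real.sin θ)) (g := G)
    (fun θ _ => (Real.hasDerivAt_cos θ).const_mul _)
    (Continuous.continuousOn (by fun_prop)) hcont
  simp only [Real.cos_zero, Real.cos_pi, mul_one, mul_neg] at e3
  rw [intervalIntegral.integral_symm (-(2 * r)) (2 * r), ← e2, ← e1, eq_comm,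
    neg_eq_iff_eq_neg] at e3
  rw [e3, ← intervalIntegral.integral_neg]
  have e4 : ∫ θ in (0 : ℝ)..Real.pi,
        -(-(2 * r * Real.sin θ) • (G ∘ fun θ => 2 * r * Real.cos θ) θ) =
      ∫ θ in (0 : ℝ)..Real.pi, ((2 / Real.pi : ℝ) : ℂ) * ((Real.sin θ : ℂ) *
        (Real.sin θ * (1 - 2 * (r * g) * Real.cos θ + (r * g) ^ 2)⁻¹)) := by
    refine intervalIntegral.integral_congr fun θ hθ => ?_
    rw [uIcc_of_le Real.pi_pos.le] at hθ
    have hs : Real.sqrt (4 * t - (2 * r * Real.cos θ) ^ 2) = 2 * r * Real.sin θ := by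
      rw [← Real.sqrt_sq (by have := Real.sin_nonneg_of_mem_Icc hθ; positivity :
        0 ≤ 2 * r * Real.sin θ)]
      congr 1
      rw [← hrt]
      nlinarith [Real.sin_sq_add_cos_sq θ]
    simp only [Function.comp, G, hden, hs, Complex.real_smul]
    have hpi : (Real.pi : ℂ) ≠ 0 := by exact_mod_cast Real.pi_ne_zero
    have hrC : (r : ℂ) ≠ 0 := by exact_mod_cast hr.ne'
    push_cast
    rw [← hrtC]
    field_simp
  rw [e4, intervalIntegral.integral_const_mul, integral_sin_sq_mul_inv hg]
  have hpi := Real.pi_ne_zero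
  rw [← Complex.ofReal_mul]
  norm_cast
  field_simp

/-! ### Resolvents near infinity from moments. -/

section Moments

variable {A : Type*} [CStarAlgebra A] {φ : A →L[ℂ] ℂ} {a : A} {μ : Measure ℝ}

theorem hasSum_inverse_one_sub {x : A} (hx : ‖x‖ < 1) :
    HasSum (fun n : ℕ => x ^ n) (Ring.inverse (1 - x)) :=
  hasSum_geom_series_inverse x hx

/-- The resolvent of an element near infinity is determined by its distribution. -/
theorem HasDistribution.exists_map_inverse_eq (h : HasDistribution φ a μ) :
    ∃ r > 0, ∀ u : ℂ, ‖u‖ < r →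
      φ (Ring.inverse (1 - u • a)) = ∫ x : ℝ, (1 - u * x)⁻¹ ∂μ := by
  have := h.isProbabilityMeasure
  obtain ⟨M, hM⟩ := h.isCompact_support.isBounded.exists_norm_le
  have hM' : ∀ᵐ x ∂μ, ‖x‖ ≤ M := by
    filter_upwards [Measure.support_mem_ae (μ := μ)] with x hx using hM x hx
  -- `L` dominates both `‖a‖` and the support, so for `‖u‖ < L⁻¹` the Neumann series and the
  -- geometric series under the integral both converge.
  set L := |M| + ‖a‖ + 1
  have hL : 0 < L := by positivity
  refine ⟨L⁻¹, by positivity, fun u hu => ?_⟩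
  have hu1 : ‖u‖ * L < 1 := by rwa [← lt_inv_mul_iff₀' hL, mul_one]
  have hu2 : ‖u‖ * |M| < 1 :=
    lt_of_le_of_lt (by gcongr; simp only [L]; linarith [norm_nonneg a]) hu1
  have hua : ‖u • a‖ < 1 := by
    rw [norm_smul]
    exact lt_of_le_of_lt (by gcongr; simp only [L]; linarith [abs_nonneg M]) hu1
  have hF : ∀ᵐ x : ℝ ∂μ, ‖u * x‖ ≤ ‖u‖ * |M| := by
    filter_upwards [hM'] with x hx
    rw [norm_mul, Complex.norm_real]
    gcongr
    exact hx.trans (le_abs_self M)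
  have hFn (n : ℕ) : ∀ᵐ x : ℝ ∂μ, ‖(u * x) ^ n‖ ≤ (‖u‖ * |M|) ^ n := by
    filter_upwards [hF] with x hx
    rw [norm_pow]
    gcongr
  have hint (n : ℕ) : Integrable (fun x : ℝ => (u * x) ^ n) μ :=
    Integrable.of_bound (by fun_prop) _ (hFn n)
  have s1 := hasSum_integral_of_summable_integral_norm (μ := μ) hint (by
    refine Summable.of_nonneg_of_le (fun n => by positivity) (fun n => ?_)
      (summable_geometric_of_lt_one (by positivity) hu2)
    have := integral_mono_ae (hint n).norm (integrable_const ((‖u‖ * |M|) ^ n)) (hFn n)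
    simpa using this)
  have s2 := (hasSum_inverse_one_sub hua).mapL φ
  have e (n : ℕ) : φ ((u • a) ^ n) = ∫ x : ℝ, (u * x) ^ n ∂μ := by
    rw [smul_pow, map_smul, h.moment_eq, ← integral_complex_ofReal, smul_eq_mul,
      ← integral_const_mul]
    simp_rw [mul_pow, Complex.ofReal_pow]
  simp_rw [e] at s2
  rw [s2.unique s1]
  refine integral_congr_ae ?_
  filter_upwards [hF] with x hx
  exact tsum_geometric_of_norm_lt_one (hx.trans_lt hu2)

end Moments

/-! ### Freeness for resolvents. -/

section Freeness

/-- The product `x y x y ⋯` with `n` factors. -/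
def alternatingProd {A : Type*} [Monoid A] : A → A → ℕ → A
  | _, _, 0 => 1
  | x, y, n + 1 => x * alternatingProd y x n

theorem alternatingProd_two_mul {A : Type*} [Monoid A] (x y : A) (n : ℕ) :
    alternatingProd x y (2 * n) = (x * y) ^ n := by
  induction n with
  | zero => simp [alternatingProd]
  | succ n ih =>
    rw [pow_succ', ← ih, mul_assoc]
    rfl

theorem alternatingProd_two_mul_add_one {A : Type*} [Monoid A] (x y : A) (n : ℕ) :
    alternatingProd x y (2 * n + 1) = (x * y) ^ n * x := by
  rw [alternatingProd, alternatingProd_two_mul]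
  exact (mul_pow_mul x y n).symm

theorem continuous_alternatingProd {A : Type*} [Monoid A] [TopologicalSpace A] [ContinuousMul A]
    (n : ℕ) : Continuous fun p : A × A => alternatingProd p.1 p.2 n := by
  induction n with
  | zero => exact continuous_const
  | succ n ih => exact continuous_fst.mul (ih.comp continuous_swap)

/-- The word `x y x y ⋯` with `n` letters, with its labels. -/
def alternatingWord {A : Type*} : Bool → A → A → ℕ → List (Bool × A)
  | _, _, _, 0 => []
  | i, x, y, n + 1 => (i, x) :: alternatingWord (!i) y x n

theorem prod_alternatingWord {A : Type*} [Monoid A] (i : Bool) (x y : A) (n : ℕ) :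
    ((alternatingWord i x y n).map Prod.snd).prod = alternatingProd x y n := by
  induction n generalizing i x y with
  | zero => rfl
  | succ n ih => simp [alternatingWord, alternatingProd, ih]

theorem isChain_alternatingWord {A : Type*} (i : Bool) (x y : A) (n : ℕ) :
    (alternatingWord i x y n).IsChain fun p q => p.1 ≠ q.1 := by
  induction n generalizing i x y with
  | zero => exact List.IsChain.nil
  | succ n ih =>
    cases n with
    | zero => exact List.isChain_singleton _
    | succ n => exact List.isChain_cons_cons.mpr ⟨by simp, ih (!i) y x⟩

theorem forall_mem_alternatingWord {A : Type*} {P : Bool → A → Prop} {i : Bool} {x y : A}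
    (hx : P i x) (hy : P (!i) y) (n : ℕ) : ∀ p ∈ alternatingWord i x y n, P p.1 p.2 := by
  induction n generalizing i x y with
  | zero => simp [alternatingWord]
  | succ n ih =>
    rw [alternatingWord, List.forall_mem_cons]
    exact ⟨hx, ih hy (by simpa using hx)⟩

variable {A : Type*} [CStarAlgebra A] {φ : A →L[ℂ] ℂ} {a b : A}

/-- The centred elements of the closed algebra generated by `a`. -/
def centredClosure (φ : A →L[ℂ] ℂ) (a : A) : Set A :=
  closure {x | x ∈ Algebra.adjoin ℂ {a} ∧ φ x = 0}

/-- The centring map `y ↦ y - φ(y) 1` is continuous, sends the algebra to its centred elements and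
fixes `x`. -/
theorem mem_centredClosure (h1 : φ 1 = 1) {x : A}
    (hx : x ∈ closure (Algebra.adjoin ℂ {a} : Set A)) (h0 : φ x = 0) :
    x ∈ centredClosure φ a := by
  have hc : Continuous fun y : A => y - φ y • (1 : A) := by fun_prop
  have := map_mem_closure (t := {x | x ∈ Algebra.adjoin ℂ {a} ∧ φ x = 0}) hc hx fun y hy =>
    ⟨sub_mem hy (Subalgebra.smul_mem _ (one_mem _) _), by simp [h1]⟩
  rw [centredClosure]
  simpa only [h0, zero_smul, sub_zero] using this

/-- Freeness concerns polynomials in `a` and `b`, whereas resolvents are only norm limits of these;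
continuity of `φ` and of the product bridges the gap. -/
theorem AreFree.map_alternatingProd_eq_zero_of_mem (h : AreFree φ a b) {i : Bool} {x y : A}
    (hx : x ∈ centredClosure φ (if i then a else b))
    (hy : y ∈ centredClosure φ (if i then b else a)) {n : ℕ} (hn : n ≠ 0) :
    φ (alternatingProd x y n) = 0 := by
  have hmem : (x, y) ∈ closure ({x | x ∈ Algebra.adjoin ℂ {if i then a else b} ∧ φ x = 0} ×ˢ
      {x | x ∈ Algebra.adjoin ℂ {if i then b else a} ∧ φ x = 0}) := by
    rw [closure_prod_eq]
    exact ⟨hx, hy⟩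
  have hcl : IsClosed {p : A × A | φ (alternatingProd p.1 p.2 n) = 0} :=
    isClosed_eq (φ.continuous.comp (continuous_alternatingProd n)) continuous_const
  refine closure_minimal ?_ hcl hmem
  rintro ⟨x, y⟩ ⟨hx, hy⟩
  have := h (alternatingWord i x y n) (by
    cases n with
    | zero => exact absurd rfl hn
    | succ n => simp [alternatingWord]) (isChain_alternatingWord i x y n)
    (forall_mem_alternatingWord
      (P := fun j z => z ∈ (if j then Algebra.adjoin ℂ {a} else Algebra.adjoin ℂ {b}) ∧ φ z = 0)
      (by cases i <;> exact hx) (by cases i <;> exact hy) n)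
  rwa [prod_alternatingWord] at this

/-- For free centred `α` and `β`, the functional takes the value `1` at
`(1 + β) (1 - αβ)⁻¹ (1 + α)`. -/
theorem AreFree.map_one_add_mul_inverse_mul_one_add (h : AreFree φ a b) (h1 : φ 1 = 1) {α β : A}
    (hα : α ∈ centredClosure φ a) (hβ : β ∈ centredClosure φ b) (hαβ : ‖α * β‖ < 1) :
    φ ((1 + β) * Ring.inverse (1 - α * β) * (1 + α)) = 1 := by
  have ht (n : ℕ) (hn : n ≠ 0) : φ (alternatingProd α β n) = 0 :=
    h.map_alternatingProd_eq_zero_of_mem (i := true) hα hβ hn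
  have hf (n : ℕ) (hn : n ≠ 0) : φ (alternatingProd β α n) = 0 :=
    h.map_alternatingProd_eq_zero_of_mem (i := false) hβ hα hn
  have s := ((((hasSum_inverse_one_sub hαβ).mul_left (1 + β)).mul_right (1 + α))).mapL φ
  have e (n : ℕ) : φ ((1 + β) * (α * β) ^ n * (1 + α)) = if n = 0 then 1 else 0 := by
    -- Each term of the Neumann series is a sum of four alternating words; all are killed by `φ`
    -- except the empty word, which occurs for `n = 0`.
    have e2 : (1 + β) * (α * β) ^ n * (1 + α) =
        alternatingProd α β (2 * n) + alternatingProd β α (2 * n + 1) +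
        alternatingProd α β (2 * n + 1) + alternatingProd β α (2 * n + 2) := by
      rw [alternatingProd_two_mul_add_one α β, alternatingProd_two_mul α β,
        alternatingProd.eq_2 β α (2 * n + 1), alternatingProd.eq_2 β α (2 * n),
        alternatingProd_two_mul_add_one α β, alternatingProd_two_mul α β]
      noncomm_ring
    rw [e2, map_add, map_add, map_add, hf _ (by omega), ht (2 * n + 1) (by omega), hf _ (by omega)]
    split_ifs with hn
    · simp [hn, alternatingProd, h1]
    · rw [ht _ (by omega)]
      simp
  simp_rw [e] at s
  exact s.unique (hasSum_ite_eq 0 1)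

theorem inverse_one_sub_smul_mem_closure {u : ℂ} (hu : ‖u • a‖ < 1) :
    Ring.inverse (1 - u • a) ∈ closure (Algebra.adjoin ℂ {a} : Set A) := by
  refine mem_closure_of_tendsto (hasSum_inverse_one_sub hu).tendsto_sum_nat
    (Eventually.of_forall fun n => ?_)
  refine sum_mem fun k _ => pow_mem (Subalgebra.smul_mem _ ?_ _) _
  exact Algebra.subset_adjoin rfl

theorem smul_inverse_sub_one_mem_centredClosure (h1 : φ 1 = 1) {u : ℂ} (hu : ‖u • a‖ < 1)
    (h0 : φ (Ring.inverse (1 - u • a)) ≠ 0) :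
    (φ (Ring.inverse (1 - u • a)))⁻¹ • Ring.inverse (1 - u • a) - 1 ∈ centredClosure φ a := by
  refine mem_centredClosure h1 ?_ (by simp [h0, h1])
  exact (Algebra.adjoin ℂ {a}).topologicalClosure.sub_mem
    (Subalgebra.smul_mem _ (inverse_one_sub_smul_mem_closure hu) _) (one_mem _)

end Freeness

/-! ### Additivity of the R-transform. -/

/-- The identity behind the additivity of the R-transform. -/
theorem add_sub_smul_mul_eq_one {A : Type*} [Ring A] [Algebra ℂ A] {g : ℂ} (hg : g ≠ 0)
    {X Y α β S : A} (hX : X * (g • (1 + α)) = 1) (hY : Y * (g • (1 + β)) = 1)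
    (hS : (1 - α * β) * S = 1) :
    (X + Y - g⁻¹ • 1) * (g • ((1 + β) * S * (1 + α))) = 1 := by
  -- `Y · g(1 + β) = 1` cancels the 1 of `g⁻¹ · g(1 + β) = 1 + β`, and the remaining `-β` is
  -- absorbed through `g X α = 1 - g X`.
  have e : (X + Y - g⁻¹ • 1) * (g • (1 + β)) = g • (X * (1 - α * β)) := by
    have hX' : g • (X * α) = 1 - g • X := by
      rw [mul_smul_comm, mul_add, mul_one, smul_add] at hX
      exact eq_sub_of_add_eq' hX
    rw [sub_mul, add_mul, hY, smul_mul_smul_comm, inv_mul_cancel₀ hg, one_smul, one_mul,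
      mul_sub, smul_sub, ← mul_assoc, ← smul_mul_assoc g (X * α), hX', mul_smul_comm, sub_mul,
      mul_add, smul_add, smul_mul_assoc]
    simp only [mul_one, one_mul]
    abel
  calc (X + Y - g⁻¹ • 1) * (g • ((1 + β) * S * (1 + α)))
      = ((X + Y - g⁻¹ • 1) * (g • (1 + β))) * (S * (1 + α)) := by
        simp only [mul_smul_comm, smul_mul_assoc, mul_assoc]
    _ = (g • (X * (1 - α * β))) * (S * (1 + α)) := by rw [e]
    _ = g • (X * ((1 - α * β) * S) * (1 + α)) := by
        simp only [smul_mul_assoc, mul_assoc]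
    _ = 1 := by rw [hS, mul_one, ← mul_smul_comm, hX]

/-! ### The functional equation of the free convolution. -/

section FreeConvolution

variable {A : Type*} [CStarAlgebra A] {φ : A →L[ℂ] ℂ} {a b : A} {μ ν : Measure ℝ} {t : ℝ}

theorem HasDistribution.exists_stieltjes_inv_eq (h : HasDistribution φ a μ) :
    ∃ r > 0, ∀ u : ℂ, ‖u‖ < r → u ≠ 0 →
      stieltjes μ u⁻¹ = -(u * φ (Ring.inverse (1 - u • a))) := by
  obtain ⟨r, hr, hφ⟩ := h.exists_map_inverse_eq
  refine ⟨r, hr, fun u hu hu0 => ?_⟩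
  rw [hφ u hu, stieltjes, ← neg_mul, ← integral_const_mul]
  refine integral_congr_ae (ae_of_all _ fun x => ?_)
  have : (x : ℂ) - u⁻¹ = (-u)⁻¹ * (1 - u * x) := by field_simp; ring
  simp only [this, mul_inv, inv_inv]

/-- For `g ≠ 0` the resolvent parameter `g / (1 + t g²)` is the reciprocal of `1/g + t g`: the
Cauchy transform of the semicircle law takes the value `g` there. -/
theorem exists_map_inverse_eq_of_semicircleLaw (ht : 0 < t)
    (h : HasDistribution φ a (semicircleLaw t)) :
    ∃ r > 0, ∀ g : ℂ, 1 + t * g ^ 2 ≠ 0 → ‖g / (1 + t * g ^ 2)‖ < r →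
      ‖(Real.sqrt t : ℂ) * g‖ < 1 →
      φ (Ring.inverse (1 - (g / (1 + t * g ^ 2)) • a)) = 1 + t * g ^ 2 := by
  obtain ⟨r, hr, hφ⟩ := h.exists_map_inverse_eq
  refine ⟨r, hr, fun g hk hgr hg => ?_⟩
  have e := congrArg ((1 + t * g ^ 2) * ·) (integral_semicircleLaw_inv ht hg)
  simp only [mul_one, ← integral_const_mul] at e
  rw [hφ _ hgr]
  refine Eq.trans ?_ e
  refine integral_congr_ae (ae_of_all _ fun x => ?_)
  have : 1 - g / (1 + t * g ^ 2) * x = (1 + t * g ^ 2)⁻¹ * (1 + t * g ^ 2 - g * x) := by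
    rw [mul_sub, inv_mul_cancel₀ hk]
    ring
  simp only [this, mul_inv, inv_inv]

theorem inverse_eq_of_mul_eq_one {R : Type*} [Ring R] {p q : R} (hp : IsUnit p) (h : p * q = 1) :
    Ring.inverse p = q := by
  rw [← Ring.inverse_mul_cancel_left p q hp, h, mul_one]

theorem smul_one_sub_mul_smul_inverse {R : Type*} [Ring R] [Algebra ℂ R] {u g k : ℂ} {x : R}
    (hu : u ≠ 0) (hk : k ≠ 0) (hg : g = u * k) (hx : IsUnit (1 - u • x)) :
    (u⁻¹ • (1 : R) - x) * (g • (1 + (k⁻¹ • Ring.inverse (1 - u • x) - 1))) = 1 := by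
  have e : u⁻¹ • (1 : R) - x = u⁻¹ • (1 - u • x) := by
    rw [smul_sub, smul_smul, inv_mul_cancel₀ hu, one_smul]
  rw [e, add_sub_cancel, smul_smul, smul_mul_smul_comm, Ring.mul_inverse_cancel _ hx, hg]
  rw [show u⁻¹ * (u * k * k⁻¹) = 1 by field_simp, one_smul]

/-- The resolvent of the sum of two free elements. -/
theorem AreFree.map_inverse_add_eq (h : AreFree φ a b) (h1 : φ 1 = 1) {u₁ u₂ v g k s : ℂ}
    (hu₁ : u₁ ≠ 0) (hu₂ : u₂ ≠ 0) (hv : v ≠ 0) (hk : k ≠ 0) (hs : s ≠ 0)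
    (hk' : φ (Ring.inverse (1 - u₁ • a)) = k) (hs' : φ (Ring.inverse (1 - u₂ • b)) = s)
    (hgk : g = u₁ * k) (hgs : g = u₂ * s) (hvg : v⁻¹ = u₁⁻¹ + u₂⁻¹ - g⁻¹)
    (ha : ‖u₁ • a‖ < 1) (hb : ‖u₂ • b‖ < 1) (hab : ‖v • (a + b)‖ < 1)
    (hαβ : ‖(k⁻¹ • Ring.inverse (1 - u₁ • a) - 1) * (s⁻¹ • Ring.inverse (1 - u₂ • b) - 1)‖ < 1) :
    φ (Ring.inverse (1 - v • (a + b))) = v⁻¹ * g := by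
  have hg : g ≠ 0 := hgk ▸ mul_ne_zero hu₁ hk
  have hα := smul_inverse_sub_one_mem_centredClosure h1 ha (hk'.symm ▸ hk)
  have hβ := smul_inverse_sub_one_mem_centredClosure h1 hb (hs'.symm ▸ hs)
  rw [hk'] at hα
  rw [hs'] at hβ
  have hX := smul_one_sub_mul_smul_inverse hu₁ hk hgk (isUnit_one_sub_of_norm_lt_one ha)
  have hY := smul_one_sub_mul_smul_inverse hu₂ hs hgs (isUnit_one_sub_of_norm_lt_one hb)
  have hm := h.map_one_add_mul_inverse_mul_one_add h1 hα hβ hαβ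
  have key := add_sub_smul_mul_eq_one hg hX hY
    (Ring.mul_inverse_cancel _ (isUnit_one_sub_of_norm_lt_one hαβ))
  have e : u₁⁻¹ • (1 : A) - a + (u₂⁻¹ • (1 : A) - b) - g⁻¹ • (1 : A) =
      v⁻¹ • (1 - v • (a + b)) := by
    rw [smul_sub, smul_smul, inv_mul_cancel₀ hv, one_smul, hvg, sub_smul, add_smul]
    abel
  rw [e, smul_mul_assoc, ← mul_smul_comm] at key
  rw [inverse_eq_of_mul_eq_one (isUnit_one_sub_of_norm_lt_one hab) key, map_smul, map_smul, hm]
  simp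

theorem ContinuousAt.inverse_one_sub_smul {f : ℂ → ℂ} {c : ℂ} (hf : ContinuousAt f c)
    (h0 : f c = 0) (x : A) : ContinuousAt (fun u => Ring.inverse (1 - f u • x)) c := by
  have h : ContinuousAt Ring.inverse (1 - f c • x) := by
    simpa [h0] using NormedRing.inverse_continuousAt (1 : Aˣ)
  exact ContinuousAt.comp (f := fun u => 1 - f u • x) h (by fun_prop)

theorem eventually_norm_lt {E : Type*} [NormedAddCommGroup E] {f : ℂ → E} {c : ℂ}
    (hf : ContinuousAt f c) (h0 : f c = 0) {r : ℝ} (hr : 0 < r) : ∀ᶠ u in 𝓝 c, ‖f u‖ < r :=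
  hf.norm.eventually_lt_const (by simpa [h0] using hr)

/-- The functional equation of the free convolution with a semicircle law, near infinity. -/
theorem AreFree.eventually_stieltjes_eq (h : AreFree φ a b) (h1 : φ 1 = 1) (ht : 0 < t)
    (ha : HasDistribution φ a (semicircleLaw t)) (hb : HasDistribution φ b ν)
    (hab : HasDistribution φ (a + b) μ) :
    ∀ᶠ u in 𝓝[≠] (0 : ℂ),
      stieltjes μ (u⁻¹ - t * stieltjes ν u⁻¹) = stieltjes ν u⁻¹ := by
  obtain ⟨ra, hra, hφa⟩ := exists_map_inverse_eq_of_semicircleLaw ht ha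
  obtain ⟨rb, hrb, hφb⟩ := hb.exists_stieltjes_inv_eq
  obtain ⟨rc, hrc, hφc⟩ := hab.exists_stieltjes_inv_eq
  -- `g u` is the Cauchy transform of `b` at `u⁻¹`; `u₁ u` is chosen so that `a` has the same Cauchy
  -- transform at `(u₁ u)⁻¹ = 1/g + t g`. Then `v⁻¹ = u₁⁻¹ + u⁻¹ - g⁻¹ = u⁻¹ + t g`; `v` is written
  -- as a quotient continuous at 0. As `α` and `β` vanish at 0, all smallness conditions hold near
  -- 0.
  set s : ℂ → ℂ := fun u => φ (Ring.inverse (1 - u • b)) with hs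
  set g : ℂ → ℂ := fun u => u * s u with hg
  set k : ℂ → ℂ := fun u => 1 + t * g u ^ 2 with hk
  set u₁ : ℂ → ℂ := fun u => g u / k u with hu₁
  set v : ℂ → ℂ := fun u => u / (1 + t * (u * g u)) with hv
  set α : ℂ → A := fun u => (k u)⁻¹ • Ring.inverse (1 - u₁ u • a) - 1 with hα
  set β : ℂ → A := fun u => (s u)⁻¹ • Ring.inverse (1 - u • b) - 1 with hβ
  have hs0 : s 0 = 1 := by simp [hs, h1]
  have hg0 : g 0 = 0 := by simp [hg]
  have hk0 : k 0 = 1 := by simp [hk, hg0]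
  have hu₁0 : u₁ 0 = 0 := by simp [hu₁, hg0]
  have hv0 : v 0 = 0 := by simp [hv]
  have hα0 : α 0 = 0 := by simp [hα, hk0, hu₁0]
  have hβ0 : β 0 = 0 := by simp [hβ, hs0]
  have cY : ContinuousAt (fun u : ℂ => Ring.inverse (1 - u • b)) 0 :=
    ContinuousAt.inverse_one_sub_smul (f := fun u => u) continuousAt_id rfl b
  have cs : ContinuousAt s 0 := φ.continuous.continuousAt.comp cY
  have cg : ContinuousAt g 0 := continuousAt_id.mul cs
  have ck : ContinuousAt k 0 := by fun_prop
  have cu₁ : ContinuousAt u₁ 0 := cg.div ck (by simp [hk0])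
  have cv : ContinuousAt v 0 := ContinuousAt.div continuousAt_id (by fun_prop) (by simp)
  have cα : ContinuousAt α 0 :=
    ((ck.inv₀ (by simp [hk0])).smul (cu₁.inverse_one_sub_smul hu₁0 a)).sub continuousAt_const
  have cβ : ContinuousAt β 0 := ((cs.inv₀ (by simp [hs0])).smul cY).sub continuousAt_const
  have cd : ContinuousAt (fun u => 1 + t * (u * g u)) 0 := by fun_prop
  have main : ∀ᶠ u in 𝓝 (0 : ℂ), u ≠ 0 →
      stieltjes μ (u⁻¹ - t * stieltjes ν u⁻¹) = stieltjes ν u⁻¹ := by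
    filter_upwards [cs.eventually_ne (by simp [hs0] : s 0 ≠ 0),
      ck.eventually_ne (by simp [hk0] : k 0 ≠ 0),
      cd.eventually_ne (by simp : (1 : ℂ) + t * (0 * g 0) ≠ 0),
      eventually_norm_lt cu₁ hu₁0 hra, eventually_norm_lt cv hv0 hrc,
      eventually_norm_lt (f := fun u : ℂ => u) continuousAt_id rfl hrb,
      eventually_norm_lt (f := fun u : ℂ => (Real.sqrt t : ℂ) * g u) (by fun_prop)
        (by simp [hg0]) one_pos,
      eventually_norm_lt (f := fun u : ℂ => u₁ u • a) (by fun_prop) (by simp [hu₁0]) one_pos,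
      eventually_norm_lt (f := fun u : ℂ => u • b) (by fun_prop) (by simp) one_pos,
      eventually_norm_lt (f := fun u : ℂ => v u • (a + b)) (by fun_prop) (by simp [hv0]) one_pos,
      eventually_norm_lt (f := fun u : ℂ => α u * β u) (by fun_prop) (by simp [hα0]) one_pos]
      with u e1 e2 e3 e4 e5 e6 e7 e8 e9 e10 e11 hu
    have hgu : g u ≠ 0 := mul_ne_zero hu e1
    have hu₁u : u₁ u ≠ 0 := div_ne_zero hgu e2
    have hvu : v u ≠ 0 := div_ne_zero hu e3
    have hvinv : (v u)⁻¹ = u⁻¹ + t * g u := by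
      simp only [hv, inv_div]
      field_simp
    have hu₁inv : (u₁ u)⁻¹ = (g u)⁻¹ + t * g u := by
      simp only [hu₁, hk, inv_div]
      field_simp
    have key := h.map_inverse_add_eq h1 (g := g u) hu₁u hu hvu e2 e1 (hφa (g u) e2 e4 e7) rfl
      (by simp only [hu₁]; field_simp) rfl (by rw [hvinv, hu₁inv]; ring) e8 e9 e10 e11
    have hν : stieltjes ν u⁻¹ = -g u := hφb u e6 hu
    have hμ := hφc (v u) e5 hvu
    rw [key, mul_inv_cancel_left₀ hvu, hvinv] at hμ
    rw [hν, mul_neg, sub_neg_eq_add, hμ]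
  exact eventually_nhdsWithin_of_eventually_nhds main |>.mp
    (by filter_upwards [self_mem_nhdsWithin] with u hu hmain using hmain hu)

theorem norm_stieltjes_le {ν : Measure ℝ} [IsProbabilityMeasure ν] {w : ℂ} (hw : 0 < w.im) :
    ‖stieltjes ν w‖ ≤ w.im⁻¹ := by
  have := norm_integral_le_of_norm_le_const (μ := ν) (C := w.im⁻¹)
    (f := fun x : ℝ => ((x : ℂ) - w)⁻¹) (ae_of_all _ fun x => by
      rw [norm_inv]
      refine inv_anti₀ hw ?_
      have := Complex.abs_im_le_norm ((x : ℂ) - w)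
      simpa [abs_of_pos hw] using this)
  simpa [stieltjes] using this

/-- With `H(w) = w - t m_ν(w)`, the hypothesis says `m_μ(H(w)) = m_ν(w)` near infinity, which is the
functional equation at `z = H(w)`. Such `z` accumulate at a point of the upper half plane, where
both sides are analytic. -/
theorem SemicircleSubordinate.of_eventually [IsProbabilityMeasure μ] [IsProbabilityMeasure ν]
    (ht : 0 < t) (h : ∀ᶠ u in 𝓝[≠] (0 : ℂ),
      stieltjes μ (u⁻¹ - t * stieltjes ν u⁻¹) = stieltjes ν u⁻¹) :
    SemicircleSubordinate t μ ν := by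
  have hR : ∀ᶠ w in Bornology.cobounded ℂ,
      stieltjes μ (w - t * stieltjes ν w) = stieltjes ν w := by
    simpa using (tendsto_inv₀_cobounded' (α := ℂ)).eventually h
  obtain ⟨R, -, hR⟩ := (hasBasis_cobounded_norm (E := ℂ)).eventually_iff.mp hR
  set H : ℂ → ℂ := fun w => w - t * stieltjes ν w with hH
  -- High enough that `|w₀| > R` and that `Im H(w₀) ≥ Y - t > 0`.
  set Y : ℝ := |R| + t + 1
  have hY : 1 ≤ Y := by have := abs_nonneg R; simp only [Y]; linarith
  set w₀ : ℂ := Y * Complex.I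
  have hw₀ : w₀.im = Y := by simp [w₀]
  have hw₀n : R < ‖w₀‖ := by
    have : ‖w₀‖ = Y := by simp [w₀, abs_of_pos (by linarith : 0 < Y)]
    rw [this]
    have := le_abs_self R
    simp only [Y]
    linarith
  have hoff₀ : OffSupport ν w₀ := offSupport_of_im_pos (by rw [hw₀]; linarith)
  have hHc : ContinuousAt H w₀ := continuousAt_id.sub (continuousAt_const.mul hoff₀.continuousAt)
  have hnear : ∀ᶠ w in 𝓝 w₀, stieltjes μ (H w) = stieltjes ν w := by
    filter_upwards [continuousAt_id.norm.eventually_const_lt hw₀n] with w hw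
    exact hR hw.le
  have hHim : 0 < (H w₀).im := by
    have h1 := norm_stieltjes_le (ν := ν) (w := w₀) (by rw [hw₀]; linarith)
    have h2 := (Complex.im_le_norm (stieltjes ν w₀)).trans h1
    rw [hw₀] at h2
    have h3 : Y⁻¹ ≤ 1 := inv_le_one_of_one_le₀ hY
    have h4 : (H w₀).im = Y - t * (stieltjes ν w₀).im := by simp [hH, hw₀]
    have h5 : t * (stieltjes ν w₀).im ≤ t * 1 := by gcongr; linarith
    have := abs_nonneg R
    rw [h4]
    simp only [Y]
    linarith
  -- `H` is injective near `w₀`: `H(w)` determines `m_ν(w) = m_μ(H(w))`, hence `w = H(w) + t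
  -- m_ν(w)`.
  have hHne : Tendsto H (𝓝[≠] w₀) (𝓝[≠] (H w₀)) := by
    refine tendsto_nhdsWithin_iff.mpr ⟨hHc.tendsto.mono_left nhdsWithin_le_nhds, ?_⟩
    filter_upwards [nhdsWithin_le_nhds hnear, self_mem_nhdsWithin] with w hw hne heq
    refine hne ?_
    have e : stieltjes ν w = stieltjes ν w₀ := by
      rw [← hw, ← hnear.self_of_nhds, mem_singleton_iff.mp heq]
    have := mem_singleton_iff.mp heq
    simp only [hH, e] at this
    exact mem_singleton_iff.mpr (sub_left_injective this)
  have hopen : IsOpen {z : ℂ | 0 < z.im} := isOpen_lt continuous_const Complex.continuous_im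
  have hd : DifferentiableOn ℂ (stieltjes μ) {z : ℂ | 0 < z.im} := fun z hz =>
    (offSupport_of_im_pos hz).differentiableAt.differentiableWithinAt
  have hd2 : DifferentiableOn ℂ (fun z => stieltjes ν (z + t * stieltjes μ z))
      {z : ℂ | 0 < z.im} := by
    intro z hz
    have h1 : DifferentiableAt ℂ (stieltjes μ) z := (offSupport_of_im_pos hz).differentiableAt
    have h2 := (SemicircleSubordinate.offSupport (μ := μ) (ν := ν) ht.le hz).differentiableAt
    exact (DifferentiableAt.comp (f := fun z => z + t * stieltjes μ z) z h2
      (by fun_prop)).differentiableWithinAt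
  have hfreq : ∃ᶠ z in 𝓝[≠] (H w₀), stieltjes μ z = stieltjes ν (z + t * stieltjes μ z) := by
    refine hHne.frequently (Eventually.frequently ?_)
    filter_upwards [nhdsWithin_le_nhds hnear] with w hw
    rw [hw]
    simp [hH]
  exact fun z hz => (hd.analyticOnNhd hopen).eqOn_of_preconnected_of_frequently_eq
    (hd2.analyticOnNhd hopen) (convex_halfSpace_im_gt 0).isPreconnected hHim hfreq hz

end FreeConvolution

theorem propositionA1 (μD : Measure ℝ) [IsProbabilityMeasure μD] (hμD : IsCompact μD.support)
    (t : ℝ) (ht : 0 < t) (μt : Measure ℝ) (hμt : IsFreeConvolution (semicircleLaw t) μD μt) :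
    ∃ f : ℝ → ℝ, Continuous f ∧ (∀ x, 0 ≤ f x) ∧
      μt = volume.withDensity (fun x => ENNReal.ofReal (f x)) ∧
      ∃ c ε : ℝ, 0 < c ∧ 0 < ε ∧
        ∀ x ∈ Set.Icc (leftEdge μt) (leftEdge μt + ε), f x ≤ c * Real.sqrt (x - leftEdge μt) := by
  obtain ⟨A, _, φ, a, b, hφ, -, -, hfree, ha, hb, hab⟩ := hμt
  have := hab.isProbabilityMeasure
  exact (SemicircleSubordinate.of_eventually ht
    (hfree.eventually_stieltjes_eq hφ.map_one ht ha hb hab)).exists_density ht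
    hab.isCompact_support hμD
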